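/- Let $\mathbb F_q$ be a finite field, $\sigma\neq 1$ an automorphism of $\mathbb F_q$ with fixed field $\mathbb F_s$, and $V=\mathbb F_q^{\,n+1}$ (column vectors), with dual $V^*$ (row vectors); $x^\sigma$ denotes the vector obtained by applying $\sigma$ to all coordinates of $x$. Let $\bar\Gamma$ be the point-hyperplane geometry of $\mathrm{PG}(V)$: its points are the pairs $([x],[\xi])$ with $[x]\in\mathrm{PG}(V)$, $[\xi]\in\mathrm{PG}(V^*)$, $\xi x=0$; its lines are the sets $\{(p,H):p\in r\}$ for a line $r$ of $\mathrm{PG}(V)$ contained in the hyperplane $H$, and the sets $\{(p,H): S\subseteq H\}$ for a point $p$ and a subspace $S\ni p$ of codimension $2$. The twisted embedding is $\bar\varepsilon_\sigma([x],[\xi])=[x^\sigma\otimes\xi]=[x^\sigma\xi]\in \mathrm{PG}(M_{n+1}(q))$, and $\Lambda_\sigma=\bar\varepsilon_\sigma(\bar\Gamma)=\{[X_1],\dots,[X_N]\}$. Let $\mathcal C(\Lambda_\sigma)\subseteq\mathbb F_q^N$ be the linear code of all words $c_M=(\mathrm{Tr}(X_1M),\dots,\mathrm{Tr}(X_NM))$,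 $M\in M_{n+1}(q)$; the choice of the representatives $X_i$ is arbitrary. For $M\ne0$ let $\mathcal H_{M,\sigma}=\bar\varepsilon_\sigma^{-1}([M^\perp])$, where $M^\perp=\{X:\mathrm{Tr}(XM)=0\}$, be the hyperplane of $\bar\Gamma$ associated with $M$ (and with $c_M$). For a point $p$ and a hyperplane $A$ of $\mathrm{PG}(V)$, the quasi-singular hyperplane $\mathcal H_{p,A}$ of $\bar\Gamma$ is the set of all points of $\bar\Gamma$ collinear with a point of the form $(p,H)$ or $(x,A)$ of $\bar\Gamma$; it is called singular if $p\in A$. A hyperplane of semi-standard spread type is a set $\mathcal H_\phi=\{([x],[\xi])\in\bar\Gamma : \phi([x])\in[\xi]\}$, where $\phi$ is a fixed-point-free involutory collineation of $\mathrm{PG}(V)$ induced by a semilinear, non-linear bijection of $V$. Minimum and second lowest weights refer to non-zero codewords. Then: (1) If $n\ge2$, the code $\mathcal C(\Lambda_\sigma)$ is minimal: if $c,c'\in\mathcal C(\Lambda_\sigma)$ and $\mathrm{supp}(c')\subseteq\mathrm{supp}(c)$, then $c'=\lambda c$ for some $\lambda\in\mathbb F_q$. (2) If $n=2$ and $\sigma^2=1$,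 then $q=s^2$, the minimum weight of $\mathcal C(\Lambda_\sigma)$ is $q^3-\sqrt q^{\,3}$, and for $M\neq0$ the word $c_M$ is a minimum weight codeword if and only if there are linearly independent $\xi_1,\xi_2,\xi_3\in V^*$ and $\alpha_1,\alpha_2,\alpha_3\in\mathbb F_q\setminus\{0\}$ with $\xi_iM=\alpha_i\xi_i^\sigma$ for $i=1,2,3$ and $N(\alpha_1)=N(\alpha_2)=N(\alpha_3)$, where $N(a)=a^{s+1}$. (3) If $n>2$, or $n=2$ and $\sigma^2\ne1$, then the minimum weight of $\mathcal C(\Lambda_\sigma)$ is $q^{2n-1}-q^{n-1}$ and the second lowest weight is $q^{2n-1}$. For $M\ne0$, the word $c_M$ is a minimum weight codeword if and only if $\mathcal H_{M,\sigma}$ is quasi-singular but not singular, and it is a second lowest weight codeword if and only if $\mathcal H_{M,\sigma}$ is singular. Moreover every quasi-singular hyperplane of $\bar\Gamma$ is of the form $\mathcal H_{M,\sigma}$ with $M\neq 0$. (4) If $q$ and $n$ are both odd, then the maximum weight of $\mathcal C(\Lambda_\sigma)$ is $q^{n-1}(q^{n+1}-1)/(q-1)$. For all $q$ and $n$, if a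 hyperplane $\mathcal H$ of semi-standard spread type equals $\mathcal H_{M,\sigma}$ with $M\neq0$, then $\sigma^2=1$, $n$ is odd, and $c_M$ is a maximum weight codeword, of weight $q^{n-1}(q^{n+1}-1)/(q-1)$; and if $\sigma^2=1$, then every hyperplane of semi-standard spread type is of the form $\mathcal H_{M,\sigma}$ with $M\ne0$. -/

import Mathlib

open scoped LinearAlgebra.Projectivization Matrix

namespace TwistedCode

noncomputable section

/-! ### Linear codes -/

/-- The Hamming weight of a word: the number of its non-zero components. -/
def weight {F ι : Type*} [Zero F] (c : ι → F) : ℕ := (Function.support c).ncard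

/-- A code is minimal if, for every codeword `c`, each codeword whose support is contained in the
support of `c` is a scalar multiple of `c`. -/
def IsMinimalCode {F ι : Type*} [Field F] (C : Submodule F (ι → F)) : Prop :=
  ∀ c ∈ C, ∀ c' ∈ C, Function.support c' ⊆ Function.support c → ∃ a : F, c' = a • c

/-- The set of the weights of the non-zero codewords. -/
def weights {F ι : Type*} [Field F] (C : Submodule F (ι → F)) : Set ℕ :=
  {w | ∃ c ∈ C, c ≠ 0 ∧ weight c = w}

/-- The weights of non-zero codewords that are not the lowest one. -/
def nonMinimumWeights {F ι : Type*} [Field F] (C : Submodule F (ι → F)) : Set ℕ :=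
  {w | w ∈ weights C ∧ ∃ v ∈ weights C, v < w}

/-- `c` is a minimum weight codeword of `C`. -/
def IsMinimumWeightCodeword {F ι : Type*} [Field F] (C : Submodule F (ι → F)) (c : ι → F) : Prop :=
  c ∈ C ∧ c ≠ 0 ∧ IsLeast (weights C) (weight c)

/-- `c` is a second lowest weight codeword of `C`. -/
def IsSecondLowestWeightCodeword {F ι : Type*} [Field F] (C : Submodule F (ι → F))
    (c : ι → F) : Prop :=
  c ∈ C ∧ c ≠ 0 ∧ IsLeast (nonMinimumWeights C) (weight c)

/-- `c` is a maximum weight codeword of `C`. -/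
def IsMaximumWeightCodeword {F ι : Type*} [Field F] (C : Submodule F (ι → F)) (c : ι → F) : Prop :=
  c ∈ C ∧ c ≠ 0 ∧ IsGreatest (weights C) (weight c)

/-- `X` chooses a vector representative of each point of the set `Ω` of projective points. -/
def IsRepresentatives {F W : Type*} [Field F] [AddCommGroup W] [Module F W] {Ω : Set (ℙ F W)}
    (X : Ω → W) : Prop :=
  ∀ p : Ω, ∃ h : X p ≠ 0, Projectivization.mk F (X p) h = (p : ℙ F W)

/-- The code of a set `Ω` of projective points with vector representatives `X`: its codewords are
the families of values at the representatives of the linear functionals on the space, that is, it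
is generated by the rows of the matrix whose columns are the `X p`. -/
def projectiveCode {F W : Type*} [Field F] [AddCommGroup W] [Module F W] {Ω : Set (ℙ F W)}
    (X : Ω → W) : Submodule F (Ω → F) :=
  LinearMap.range (LinearMap.pi fun p : Ω => Module.Dual.eval F W (X p))

/-! ### The point-hyperplane geometry of `PG(n, F)`

Points are represented by (column) vectors and hyperplanes by (row) vectors, that is, by
functionals, both in coordinates. -/

/-- The points of the projective space `PG(V)`, `V = F ^ (n + 1)`. -/
abbrev PG (F : Type*) [Field F] (n : ℕ) : Type _ := ℙ F (Fin (n + 1) → F)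

/-- The points of `PG(V*)`, that is, the hyperplanes of `PG(V)`, as classes of row vectors. -/
abbrev DualPG (F : Type*) [Field F] (n : ℕ) : Type _ := ℙ F (Fin (n + 1) → F)

variable {F : Type*} [Field F] {n : ℕ}

/-- The point `p` lies on the hyperplane `H`: `ξ(x) = 0` for `p = [x]`, `H = [ξ]`. -/
def Incident (p : PG F n) (H : DualPG F n) : Prop := Projectivization.orthogonal H p

/-- The hyperplane of `V` defined by a point `[ξ]` of `PG(V*)`, i.e. the kernel of `ξ`. -/
def hyperplane (H : DualPG F n) : Submodule F (Fin (n + 1) → F) :=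
  LinearMap.ker (dotProductBilin F F H.rep)

/-- The points of the point-hyperplane geometry: incident point-hyperplane pairs. -/
structure PHPoint (F : Type*) [Field F] (n : ℕ) where
  pt : PG F n
  hyp : DualPG F n
  incident : Incident pt hyp

/-- The lines of the point-hyperplane geometry: the sets `{(p, H) : p ∈ r}` for a line `r` of
`PG(V)` contained in the hyperplane `H`, and the sets `{(p, H) : S ⊆ H}` for a point `p` and a
subspace `S` of codimension `2` of `PG(V)` with `p ∈ S`. -/
def IsLine (l : Set (PHPoint F n)) : Prop :=
  (∃ (r : Submodule F (Fin (n + 1) → F)) (H : DualPG F n),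
    Module.finrank F r = 2 ∧ r ≤ hyperplane H ∧ l = {P | P.hyp = H ∧ P.pt.submodule ≤ r}) ∨
  (∃ (p : PG F n) (S : Submodule F (Fin (n + 1) → F)),
    Module.finrank F S + 2 = n + 1 ∧ p.submodule ≤ S ∧
      l = {P | P.pt = p ∧ S ≤ hyperplane P.hyp})

/-- Two points of the point-hyperplane geometry are collinear if some line contains both. -/
def Collinear (P Q : PHPoint F n) : Prop := ∃ l, IsLine l ∧ P ∈ l ∧ Q ∈ l

/-- The set `H_{p,A}` of all points collinear with a point `(p, H)` or with a point `(x, A)`. -/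
def quasiSingular (p : PG F n) (A : DualPG F n) : Set (PHPoint F n) :=
  {P | ∃ Q : PHPoint F n, (Q.pt = p ∨ Q.hyp = A) ∧ Collinear P Q}

def IsQuasiSingular (H : Set (PHPoint F n)) : Prop :=
  ∃ (p : PG F n) (A : DualPG F n), H = quasiSingular p A

def IsSingular (H : Set (PHPoint F n)) : Prop :=
  ∃ (p : PG F n) (A : DualPG F n), Incident p A ∧ H = quasiSingular p A

/-- Hyperplanes of semi-standard spread type: the sets `{(x, H) : x, φ(x) ∈ H}`, where `φ` is a
non-linear (that is, with non-trivial companion automorphism `τ`) fixed-point-free involutory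
collineation of `PG(V)`. -/
def IsSemiStandardSpreadType (H : Set (PHPoint F n)) : Prop :=
  ∃ (τ : F ≃+* F) (f : (Fin (n + 1) → F) →ₛₗ[(τ : F →+* F)] (Fin (n + 1) → F))
    (hf : Function.Injective f),
    τ ≠ 1 ∧
    (∀ p : PG F n, Projectivization.map f hf (Projectivization.map f hf p) = p) ∧
    (∀ p : PG F n, Projectivization.map f hf p ≠ p) ∧
    H = {P | Incident (Projectivization.map f hf P.pt) P.hyp}

/-! ### The twisted embedding -/

/-- The matrix `x^σ ξ`, representing the pure tensor `x^σ ⊗ ξ`. -/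
def twistedTensor (σ : F ≃+* F) (x ξ : Fin (n + 1) → F) : Matrix (Fin (n + 1)) (Fin (n + 1)) F :=
  Matrix.vecMulVec (fun i => σ (x i)) ξ

theorem twistedTensor_ne_zero (σ : F ≃+* F) {x ξ : Fin (n + 1) → F} (hx : x ≠ 0) (hξ : ξ ≠ 0) :
    twistedTensor σ x ξ ≠ 0 := by
  obtain ⟨i, hi⟩ := Function.ne_iff.1 hx
  obtain ⟨j, hj⟩ := Function.ne_iff.1 hξ
  intro h
  have := congrFun (congrFun h i) j
  simp only [twistedTensor, Matrix.vecMulVec_apply, Matrix.zero_apply, mul_eq_zero] at this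
  simp only [EmbeddingLike.map_eq_zero_iff] at this
  exact this.elim hi hj

/-- The twisted embedding `([x], [ξ]) ↦ [x^σ ⊗ ξ]`. -/
def twistedEmbedding (σ : F ≃+* F) (P : PHPoint F n) :
    ℙ F (Matrix (Fin (n + 1)) (Fin (n + 1)) F) :=
  Projectivization.mk F (twistedTensor σ P.pt.rep P.hyp.rep)
    (twistedTensor_ne_zero σ P.pt.rep_nonzero P.hyp.rep_nonzero)

/-- The twisted embedding does not depend on the representatives. -/
theorem twistedEmbedding_mk (σ : F ≃+* F) {x ξ : Fin (n + 1) → F} (hx : x ≠ 0) (hξ : ξ ≠ 0)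
    (h : Incident (Projectivization.mk F x hx) (Projectivization.mk F ξ hξ)) :
    twistedEmbedding σ ⟨Projectivization.mk F x hx, Projectivization.mk F ξ hξ, h⟩ =
      Projectivization.mk F (twistedTensor σ x ξ) (twistedTensor_ne_zero σ hx hξ) := by
  obtain ⟨a, ha⟩ := Projectivization.exists_smul_eq_mk_rep F x hx
  obtain ⟨b, hb⟩ := Projectivization.exists_smul_eq_mk_rep F ξ hξ
  rw [twistedEmbedding, Projectivization.mk_eq_mk_iff']
  refine ⟨σ a * b, ?_⟩
  ext i j
  simp only [twistedTensor, ← ha, ← hb, Matrix.smul_apply, Matrix.vecMulVec_apply, Pi.smul_apply,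
    Units.smul_def, smul_eq_mul, map_mul]
  ring

/-- The projective system `Λ_σ`, the image of the twisted embedding. -/
def projectiveSystem (n : ℕ) (σ : F ≃+* F) : Set (ℙ F (Matrix (Fin (n + 1)) (Fin (n + 1)) F)) :=
  Set.range (twistedEmbedding (n := n) σ)

/-- `M^⊥`, the orthogonal space of `M` for the form `(X, Y) ↦ Tr(X Y)`. -/
def perp (M : Matrix (Fin (n + 1)) (Fin (n + 1)) F) :
    Submodule F (Matrix (Fin (n + 1)) (Fin (n + 1)) F) :=
  LinearMap.ker (Matrix.traceLinearMap (Fin (n + 1)) F F ∘ₗ LinearMap.mulRight F M)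

/-- The hyperplane of the point-hyperplane geometry arising from `M^⊥` via the twisted embedding,
that is, the preimage of `[M^⊥]`. -/
def arisingHyperplane (σ : F ≃+* F) (M : Matrix (Fin (n + 1)) (Fin (n + 1)) F) :
    Set (PHPoint F n) :=
  {P | (twistedEmbedding σ P).submodule ≤ perp M}

/-- The codeword `c_M`, with components `Tr(X_i M)`. -/
def codeword {Ω : Set (ℙ F (Matrix (Fin (n + 1)) (Fin (n + 1)) F))}
    (X : Ω → Matrix (Fin (n + 1)) (Fin (n + 1)) F) (M : Matrix (Fin (n + 1)) (Fin (n + 1)) F) :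
    Ω → F :=
  fun p => Matrix.trace (X p * M)

end

end TwistedCode

open scoped LinearAlgebra.Projectivization Matrix

namespace TwistedCode

/-! ### Automorphisms of finite fields -/

section FixedField

variable {F : Type*} [Field F] [Finite F]

/-! Put f(x) = M x^σ. Since Tr(x^σ ξ M) = ξ f(x) (`trace_twistedTensor_mul`), every question about
c_M becomes one about the σ-semilinear map f. If f(x) ∈ ⟨x⟩, all hyperplanes through [x] give zeros;
otherwise exactly q^(n-1) of them miss f(x). So for n ≥ 1 the weight of c_M is q^(n-1) times the
number of points that are not eigenpoints of f (`weight_codeword_eq_mul`).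

Low weight thus means many eigenpoints. Let d = dim ker f. Outside the kernel, eigenpoints lie in
the span of r ≤ n+1-d independent eigenvectors; after normalisation each free coordinate has at most
s values, which leaves at most 1+s+…+s^(r-1) points (`ncard_eigenpoints_le_sum_add_sum`). If d = n,
then M = a b^σ has rank one and its hyperplane is quasi-singular, with p = [a] and A = [b]. If d <
n, there are fewer than 1+q+…+q^(n-1) eigenpoints (`sum_pow_add_sum_pow_lt`), unless n = 2 and σ² =
1. In that plane the maximum is s²+s+1, reached when f fixes a subplane; by Hilbert 90 this happens
exactly when three independent eigenvectors have eigenvalues of equal norm.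

Minimality: if supp c_M' ⊆ supp c_M and g belongs to M', duality gives g(x) ∈ ⟨x, f(x)⟩ for every x.
The coefficient of f(x) can be chosen constant (`exists_constant_coefficient`), and subtracting that
multiple of M leaves the zero word.

Maximum weight: no eigenpoints at all. For q and n odd an antidiagonal matrix with a nonsquare entry
does this. A spread type hyperplane equal to that of M forces f to have no eigenpoints, and for n ≥
2 to have the companion automorphism of the collineation (`companion_eq_of_mem_span`). For n = 1 the
spans ⟨x, φ(x)⟩ carry no information, and the absence of such collineations over finite fields is
used instead. -/

instance finite_ringAut : Finite (F ≃+* F) :=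
  Finite.of_injective (fun e : F ≃+* F => (e : F → F)) DFunLike.coe_injective

/-- The fixed field of an automorphism. -/
def fixedField {F : Type*} [Field F] (σ : F ≃+* F) : Subfield F :=
  FixedPoints.subfield (Subgroup.zpowers σ) F

theorem mem_fixedField {F : Type*} [Field F] {σ : F ≃+* F} {a : F} :
    a ∈ fixedField σ ↔ σ a = a := by
  constructor
  · intro h
    exact h ⟨σ, Subgroup.mem_zpowers σ⟩
  · rintro h ⟨g, hg⟩
    have : Subgroup.zpowers σ ≤ MulAction.stabilizer (F ≃+* F) a := by
      rw [Subgroup.zpowers_le]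
      exact h
    exact this hg

theorem card_fixedField {F : Type*} [Field F] (σ : F ≃+* F) :
    Nat.card (fixedField σ) = Nat.card {a : F // σ a = a} :=
  Nat.card_congr (Equiv.subtypeEquivRight fun _ => mem_fixedField)

/-- Artin's theorem for the cyclic group generated by σ. -/
theorem finrank_fixedField (σ : F ≃+* F) : Module.finrank (fixedField σ) F = orderOf σ := by
  have := Fintype.ofFinite (Subgroup.zpowers σ)
  rw [← Nat.card_zpowers, Nat.card_eq_fintype_card]
  exact FixedPoints.finrank_eq_card (Subgroup.zpowers σ) F

/-- The degree of a finite field over the fixed field of an automorphism is the order of the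
automorphism. -/
theorem card_eq_card_fixed_pow_orderOf (σ : F ≃+* F) :
    Nat.card F = Nat.card {a : F // σ a = a} ^ orderOf σ := by
  rw [← card_fixedField, ← finrank_fixedField]
  exact Module.natCard_eq_pow_finrank

theorem two_le_card_fixed (σ : F ≃+* F) : 2 ≤ Nat.card {a : F // σ a = a} := by
  have : Nontrivial {a : F // σ a = a} :=
    ⟨⟨0, map_zero σ⟩, ⟨1, map_one σ⟩, fun h => zero_ne_one (congrArg Subtype.val h)⟩
  exact Finite.one_lt_card

theorem card_fixed_sq_le {σ : F ≃+* F} (hσ : σ ≠ 1) :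
    Nat.card {a : F // σ a = a} ^ 2 ≤ Nat.card F := by
  rw [card_eq_card_fixed_pow_orderOf σ]
  have h0 := orderOf_pos σ
  have h1 : orderOf σ ≠ 1 := fun h => hσ (orderOf_eq_one_iff.1 h)
  exact Nat.pow_le_pow_right (by have := two_le_card_fixed σ; omega) (by omega)

theorem card_fixed_cube_le {σ : F ≃+* F} (hσ : σ ≠ 1) (hσ2 : σ ^ 2 ≠ 1) :
    Nat.card {a : F // σ a = a} ^ 3 ≤ Nat.card F := by
  rw [card_eq_card_fixed_pow_orderOf σ]
  have h0 := orderOf_pos σ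
  have h1 : orderOf σ ≠ 1 := fun h => hσ (orderOf_eq_one_iff.1 h)
  have h2 : orderOf σ ≠ 2 := fun h => hσ2 (h ▸ pow_orderOf_eq_one σ)
  exact Nat.pow_le_pow_right (by have := two_le_card_fixed σ; omega) (by omega)

theorem card_eq_card_fixed_sq {σ : F ≃+* F} (hσ : σ ≠ 1) (hσ2 : σ ^ 2 = 1) :
    Nat.card F = Nat.card {a : F // σ a = a} ^ 2 := by
  rw [← orderOf_eq_prime hσ2 hσ]
  exact card_eq_card_fixed_pow_orderOf σ

/-- The avoidance count behind minimality needs four field elements; a non-trivial automorphism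
supplies them. -/
theorem four_le_card {σ : F ≃+* F} (hσ : σ ≠ 1) : 4 ≤ Nat.card F :=
  (Nat.pow_le_pow_left (two_le_card_fixed σ) 2).trans (card_fixed_sq_le hσ)

/-- An involutory automorphism of a field of order `s ^ 2` is the map `x ↦ x ^ s`. -/
theorem apply_eq_pow_card_fixed {σ : F ≃+* F} (hσ : σ ≠ 1) (hσ2 : σ ^ 2 = 1) (x : F) :
    σ x = x ^ Nat.card {a : F // σ a = a} := by
  have := Fintype.ofFinite (fixedField σ)
  let σ' : F ≃ₐ[fixedField σ] F :=
    AlgEquiv.ofRingEquiv (f := σ) fun a => mem_fixedField.1 a.2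
  -- The Galois group over the fixed field is cyclic of order 2, generated by x ↦ x ^ s, so σ is its
  -- power with exponent 0 or 1, and 0 is excluded.
  obtain ⟨⟨i, hi⟩, h⟩ :=
    (FiniteField.bijective_frobeniusAlgEquivOfAlgebraic_pow (fixedField σ) F).2 σ'
  rw [finrank_fixedField, orderOf_eq_prime hσ2 hσ] at hi
  have hx := fun y : F => DFunLike.congr_fun h y
  interval_cases i
  · exact absurd (RingEquiv.ext fun y => (hx y).symm) hσ
  · rw [← card_fixedField, Nat.card_eq_fintype_card]
    simpa using! (hx x).symm

/-- The norm map of a finite field to the fixed field of an involution is surjective. -/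
theorem exists_mul_apply_eq {σ : F ≃+* F} (hσ : σ ≠ 1) (hσ2 : σ ^ 2 = 1) {c : F}
    (hc : σ c = c) : ∃ a : F, a * σ a = c := by
  obtain ⟨a, ha⟩ := FiniteField.norm_surjective (fixedField σ) F ⟨c, mem_fixedField.2 hc⟩
  refine ⟨a, ?_⟩
  have h := congrArg (algebraMap (fixedField σ) F) ha
  rw [FiniteField.algebraMap_norm_eq_pow, card_eq_card_fixed_sq hσ hσ2, card_fixedField] at h
  have h2 := two_le_card_fixed σ
  -- The norm is the power map with exponent (q-1)/(s-1) = s+1, that is, a ↦ a σ(a).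
  have h3 : (Nat.card {a : F // σ a = a} ^ 2 - 1) / (Nat.card {a : F // σ a = a} - 1) =
      Nat.card {a : F // σ a = a} + 1 := by
    refine Nat.div_eq_of_eq_mul_left (by omega) ?_
    simpa using Nat.sq_sub_sq (Nat.card {a : F // σ a = a}) 1
  rw [h3] at h
  rw [apply_eq_pow_card_fixed hσ hσ2, ← pow_succ']
  exact h

/-- Hilbert's Theorem 90 for an involution. -/
theorem exists_ne_zero_mul_apply_eq {F : Type*} [Field F] {σ : F ≃+* F} (hσ : σ ≠ 1)
    (hσ2 : σ ^ 2 = 1) {c : F} (hc : c * σ c = 1) : ∃ a : F, a ≠ 0 ∧ c * σ a = a := by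
  have hσσ : ∀ x, σ (σ x) = x := fun x => by
    have := congrArg (fun e : F ≃+* F => e x) hσ2
    simpa [pow_two] using this
  -- Every b + c σ(b) solves the equation. If all of them vanish, b = 1 gives c = -1, and then σ is
  -- the identity.
  have key : ∀ b, c * σ (b + c * σ b) = b + c * σ b := fun b => by
    rw [map_add, map_mul, hσσ]
    linear_combination b * hc
  by_contra! h
  have h0 : ∀ b, b + c * σ b = 0 := fun b => by
    by_contra hb
    exact h _ hb (key b)
  have hc1 : c = -1 := by
    have := h0 1
    rw [map_one] at this
    linear_combination this
  apply hσ
  ext b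
  have := h0 b
  rw [hc1] at this
  simp only [RingAut.one_apply]
  linear_combination -this

end FixedField

/-! ### The semilinear map attached to a codeword and the weight formula -/

section WeightFormula

variable {F : Type*} [Field F] {n : ℕ}

/-- The semilinear map `x ↦ M x^σ`. -/
def twistedMap (σ : F ≃+* F) (M : Matrix (Fin (n + 1)) (Fin (n + 1)) F) :
    (Fin (n + 1) → F) →ₛₗ[(σ : F →+* F)] (Fin (n + 1) → F) where
  toFun x := M *ᵥ fun i => σ (x i)
  map_add' x y := by
    rw [← Matrix.mulVec_add]
    congr 1
    ext i
    simp
  map_smul' a x := by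
    rw [← Matrix.mulVec_smul]
    congr 1
    ext i
    simp

theorem twistedMap_apply (σ : F ≃+* F) (M : Matrix (Fin (n + 1)) (Fin (n + 1)) F)
    (x : Fin (n + 1) → F) : twistedMap σ M x = M *ᵥ fun i => σ (x i) := rfl

/-- The projective points fixed or annihilated by a semilinear map. -/
def eigenpoints {V : Type*} [AddCommGroup V] [Module F V] {σ : F →+* F} (f : V →ₛₗ[σ] V) :
    Set (ℙ F V) :=
  {p | f p.rep ∈ p.submodule}

/-- Rescaling x by c multiplies the eigenvalue by σ(c)/c, so the eigenvalue depends on the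
representative but being an eigenpoint does not. -/
theorem mk_mem_eigenpoints {V : Type*} [AddCommGroup V] [Module F V] {σ : F →+* F}
    {f : V →ₛₗ[σ] V} {x : V} (hx : x ≠ 0) :
    Projectivization.mk F x hx ∈ eigenpoints f ↔ ∃ a : F, f x = a • x := by
  obtain ⟨c, hc⟩ := Projectivization.exists_smul_eq_mk_rep F x hx
  rw [eigenpoints, Set.mem_ofPred_eq, ← hc, Projectivization.submodule_mk,
    Submodule.mem_span_singleton, Units.smul_def, map_smulₛₗ]
  have hc0 : σ (c : F) ≠ 0 := by simp
  constructor
  · rintro ⟨a, ha⟩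
    refine ⟨(σ c)⁻¹ * a, ?_⟩
    rw [mul_smul, ha, inv_smul_smul₀ hc0]
  · rintro ⟨a, ha⟩
    exact ⟨σ c * a, by rw [ha, mul_smul]⟩

/-- Cyclicity of the trace; this is the bridge from codewords to semilinear maps. -/
theorem trace_twistedTensor_mul (σ : F ≃+* F) (M : Matrix (Fin (n + 1)) (Fin (n + 1)) F)
    (x ξ : Fin (n + 1) → F) : (twistedTensor σ x ξ * M).trace = ξ ⬝ᵥ twistedMap σ M x := by
  rw [twistedTensor, Matrix.trace_mul_comm, Matrix.mul_vecMulVec, Matrix.trace_vecMulVec,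
    dotProduct_comm, twistedMap_apply]

theorem mem_arisingHyperplane {σ : F ≃+* F} {M : Matrix (Fin (n + 1)) (Fin (n + 1)) F}
    {P : PHPoint F n} :
    P ∈ arisingHyperplane σ M ↔ P.hyp.rep ⬝ᵥ twistedMap σ M P.pt.rep = 0 := by
  rw [arisingHyperplane, Set.mem_ofPred_eq, twistedEmbedding, Projectivization.submodule_mk,
    Submodule.span_singleton_le_iff_mem, perp, LinearMap.mem_ker, LinearMap.comp_apply,
    LinearMap.mulRight_apply, Matrix.traceLinearMap_apply, trace_twistedTensor_mul]

theorem mk_mem_arisingHyperplane {σ : F ≃+* F} {M : Matrix (Fin (n + 1)) (Fin (n + 1)) F}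
    {x ξ : Fin (n + 1) → F} (hx : x ≠ 0) (hξ : ξ ≠ 0)
    (h : Incident (Projectivization.mk F x hx) (Projectivization.mk F ξ hξ)) :
    (⟨Projectivization.mk F x hx, Projectivization.mk F ξ hξ, h⟩ : PHPoint F n) ∈
      arisingHyperplane σ M ↔ ξ ⬝ᵥ twistedMap σ M x = 0 := by
  rw [arisingHyperplane, Set.mem_ofPred_eq, twistedEmbedding_mk, Projectivization.submodule_mk,
    Submodule.span_singleton_le_iff_mem, perp, LinearMap.mem_ker, LinearMap.comp_apply,
    LinearMap.mulRight_apply, Matrix.traceLinearMap_apply, trace_twistedTensor_mul]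

@[ext]
theorem PHPoint.ext {P Q : PHPoint F n} (h1 : P.pt = Q.pt) (h2 : P.hyp = Q.hyp) : P = Q := by
  cases P; cases Q; cases h1; cases h2; rfl

/-- A rank-one matrix determines its column and its row up to scalars. Hence the coordinates of a
codeword can be counted as points of the geometry. -/
theorem twistedEmbedding_injective (σ : F ≃+* F) :
    Function.Injective (twistedEmbedding (n := n) σ) := by
  intro P Q h
  rw [twistedEmbedding, twistedEmbedding, Projectivization.mk_eq_mk_iff] at h
  obtain ⟨a, ha⟩ := h
  have key : ∀ i j, (a : F) * (σ (Q.pt.rep i) * Q.hyp.rep j) = σ (P.pt.rep i) * P.hyp.rep j :=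
    fun i j => congrFun (congrFun ha i) j
  apply PHPoint.ext
  · obtain ⟨j, hj⟩ := Function.ne_iff.1 P.hyp.rep_nonzero
    rw [← P.pt.mk_rep, ← Q.pt.mk_rep, Projectivization.mk_eq_mk_iff']
    -- The columns x^σ are proportional, so the factor between the points themselves has to be
    -- untwisted.
    refine ⟨σ.symm (a * Q.hyp.rep j / P.hyp.rep j), ?_⟩
    ext i
    apply σ.injective
    simp only [Pi.smul_apply, smul_eq_mul, map_mul, RingEquiv.apply_symm_apply]
    have hj' : P.hyp.rep j ≠ 0 := hj
    field_simp
    linear_combination key i j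
  · obtain ⟨i, hi⟩ := Function.ne_iff.1 P.pt.rep_nonzero
    have hi' : σ (P.pt.rep i) ≠ 0 := by simpa using hi
    rw [← P.hyp.mk_rep, ← Q.hyp.mk_rep, Projectivization.mk_eq_mk_iff']
    refine ⟨a * σ (Q.pt.rep i) / σ (P.pt.rep i), ?_⟩
    ext j
    simp only [Pi.smul_apply, smul_eq_mul]
    field_simp
    linear_combination key i j

theorem codeword_apply_eq_zero_iff {σ : F ≃+* F}
    {X : projectiveSystem n σ → Matrix (Fin (n + 1)) (Fin (n + 1)) F} (hX : IsRepresentatives X)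
    (M : Matrix (Fin (n + 1)) (Fin (n + 1)) F) (P : PHPoint F n) :
    codeword X M ⟨twistedEmbedding σ P, P, rfl⟩ = 0 ↔ P ∈ arisingHyperplane σ M := by
  obtain ⟨h, hP⟩ := hX ⟨twistedEmbedding σ P, P, rfl⟩
  have h2 : P ∈ arisingHyperplane σ M ↔ (twistedEmbedding σ P).submodule ≤ perp M := Iff.rfl
  have h3 := congrArg Projectivization.submodule hP
  rw [h2, ← h3, Projectivization.submodule_mk, Submodule.span_singleton_le_iff_mem]
  rfl

theorem weight_codeword {σ : F ≃+* F}
    {X : projectiveSystem n σ → Matrix (Fin (n + 1)) (Fin (n + 1)) F} (hX : IsRepresentatives X)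
    (M : Matrix (Fin (n + 1)) (Fin (n + 1)) F) :
    weight (codeword X M) = (arisingHyperplane σ M)ᶜ.ncard := by
  have h : Function.support (codeword X M) =
      (fun P => (⟨twistedEmbedding σ P, P, rfl⟩ : projectiveSystem n σ)) ''
        (arisingHyperplane σ M)ᶜ := by
    ext ⟨p, P, rfl⟩
    rw [Function.mem_support, ne_eq, codeword_apply_eq_zero_iff hX]
    constructor
    · intro h
      exact ⟨P, h, rfl⟩
    · rintro ⟨Q, hQ, h⟩
      rw [← twistedEmbedding_injective σ (congrArg Subtype.val h)]
      exact hQ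
  rw [weight, h, Set.ncard_image_of_injective]
  intro P Q h
  exact twistedEmbedding_injective σ (congrArg Subtype.val h)

theorem mem_projectiveCode {σ : F ≃+* F}
    {X : projectiveSystem n σ → Matrix (Fin (n + 1)) (Fin (n + 1)) F}
    {c : projectiveSystem n σ → F} :
    c ∈ projectiveCode X ↔ ∃ M, codeword X M = c := by
  constructor
  · rintro ⟨φ, rfl⟩
    -- The trace form is nondegenerate; the indices are swapped because Tr(E_ji M) = M_ij.
    refine ⟨Matrix.of fun i j => φ (Matrix.single j i 1), ?_⟩
    ext p
    simp only [codeword, LinearMap.pi_apply, Module.Dual.eval_apply]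
    conv_rhs => rw [Matrix.matrix_eq_sum_single (X p)]
    simp only [map_sum, Matrix.trace, Matrix.diag, Matrix.mul_apply, Matrix.of_apply]
    refine Finset.sum_congr rfl fun i _ => Finset.sum_congr rfl fun j _ => ?_
    rw [← mul_one (X p i j), ← smul_eq_mul (X p i j) 1, ← Matrix.smul_single, map_smul]
    simp
  · rintro ⟨M, rfl⟩
    exact ⟨Matrix.traceLinearMap (Fin (n + 1)) F F ∘ₗ LinearMap.mulRight F M, rfl⟩

/-- The number of points of a projective space lying in a subspace. -/
theorem ncard_submodule_le [Finite F] {V : Type*} [AddCommGroup V] [Module F V]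
    (U : Submodule F V) :
    {p : ℙ F V | p.submodule ≤ U}.ncard =
      ∑ i ∈ Finset.range (Module.finrank F U), Nat.card F ^ i := by
  rw [← Projectivization.card_of_finrank F U rfl, ← Set.ncard_univ,
    ← Set.ncard_image_of_injective _
      (Projectivization.map_injective U.subtype U.injective_subtype)]
  congr 1
  ext p
  induction p with | h v hv =>
  simp only [Set.mem_ofPred_eq, Projectivization.submodule_mk, Submodule.span_singleton_le_iff_mem,
    Set.image_univ, Set.mem_range]
  constructor
  · intro h
    exact ⟨Projectivization.mk F ⟨v, h⟩ (fun h0 => hv (congrArg Subtype.val h0)), rfl⟩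
  · rintro ⟨w, hw⟩
    induction w with | h w hw0 =>
    rw [Projectivization.map_mk, Projectivization.mk_eq_mk_iff] at hw
    obtain ⟨a, ha⟩ := hw
    have : v = a⁻¹ • (w : V) := by
      rw [eq_inv_smul_iff]
      exact ha
    rw [this]
    exact U.smul_mem _ w.2

/-- The functionals, in coordinates, vanishing on a subspace. -/
def annihilator (U : Submodule F (Fin (n + 1) → F)) : Submodule F (Fin (n + 1) → F) where
  carrier := {ξ | ∀ x ∈ U, ξ ⬝ᵥ x = 0}
  zero_mem' x _ := zero_dotProduct x
  add_mem' h1 h2 x hx := by rw [add_dotProduct, h1 x hx, h2 x hx, add_zero]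
  smul_mem' a ξ h x hx := by rw [smul_dotProduct, h x hx, smul_zero]

theorem finrank_annihilator (U : Submodule F (Fin (n + 1) → F)) :
    Module.finrank F (annihilator U) + Module.finrank F U = n + 1 := by
  have h : annihilator U =
      U.dualAnnihilator.comap (dotProductEquiv F (Fin (n + 1))).toLinearMap := by
    ext ξ
    simp [annihilator, Submodule.mem_dualAnnihilator]
  have h2 := Subspace.finrank_add_finrank_dualAnnihilator_eq U
  rw [h, LinearEquiv.finrank_eq ((dotProductEquiv F (Fin (n + 1))).ofSubmodule' U.dualAnnihilator),
    add_comm, h2, Module.finrank_fin_fun]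

theorem mem_annihilator_span {S : Set (Fin (n + 1) → F)} {ξ : Fin (n + 1) → F} :
    ξ ∈ annihilator (Submodule.span F S) ↔ ∀ x ∈ S, ξ ⬝ᵥ x = 0 := by
  constructor
  · intro h x hx
    exact h x (Submodule.subset_span hx)
  · intro h x hx
    induction hx using Submodule.span_induction with
    | mem x hx => exact h x hx
    | zero => exact dotProduct_zero ξ
    | add x y _ _ h1 h2 => rw [dotProduct_add, h1, h2, add_zero]
    | smul a x _ h1 => rw [dotProduct_smul, h1, smul_zero]

theorem incident_iff_rep {p : PG F n} {H : DualPG F n} :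
    Incident p H ↔ H.rep ⬝ᵥ p.rep = 0 := by
  conv_lhs => rw [← p.mk_rep, ← H.mk_rep]
  exact Projectivization.orthogonal_mk _ _

/-- Otherwise adjoining y to U would raise the dimension without shrinking the annihilator. Its main
use is to turn a failure of membership in a span into a separating hyperplane. -/
theorem exists_dotProduct_ne_zero {U : Submodule F (Fin (n + 1) → F)} {y : Fin (n + 1) → F}
    (hy : y ∉ U) : ∃ ξ ∈ annihilator U, ξ ⬝ᵥ y ≠ 0 := by
  by_contra! h
  have h1 : annihilator U ≤ annihilator (U ⊔ Submodule.span F {y}) := by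
    intro ξ hξ
    have : U ⊔ Submodule.span F {y} = Submodule.span F ((U : Set _) ∪ {y}) := by
      rw [Submodule.span_union, Submodule.span_eq]
    rw [this, mem_annihilator_span]
    rintro x (hx | rfl)
    · exact hξ x hx
    · exact h ξ hξ
  have h2 := Submodule.finrank_mono h1
  have h3 := finrank_annihilator U
  have h4 := finrank_annihilator (U ⊔ Submodule.span F {y})
  have h5 : U < U ⊔ Submodule.span F {y} := by
    refine lt_of_le_of_ne le_sup_left fun h => hy ?_
    rw [h]
    exact Submodule.mem_sup_right (Submodule.mem_span_singleton_self y)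
  have h6 := Submodule.finrank_lt_finrank_of_lt h5
  omega

/-- The number of hyperplanes passing through a point but not through a second one. -/
theorem ncard_hyperplanes_not_mem [Finite F] (hn : 1 ≤ n) {x y : Fin (n + 1) → F} (hx : x ≠ 0)
    (hy : ∀ a : F, y ≠ a • x) :
    {H : DualPG F n | H.rep ⬝ᵥ x = 0 ∧ H.rep ⬝ᵥ y ≠ 0}.ncard = Nat.card F ^ (n - 1) := by
  -- The hyperplanes through x, minus those through x and y: two consecutive geometric sums, which
  -- differ by their top term.
  have hset : {H : DualPG F n | H.rep ⬝ᵥ x = 0 ∧ H.rep ⬝ᵥ y ≠ 0} =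
      {H : DualPG F n | H.submodule ≤ annihilator (Submodule.span F {x})} \
        {H : DualPG F n | H.submodule ≤ annihilator (Submodule.span F {x, y})} := by
    ext H
    simp only [Set.mem_ofPred_eq, Set.mem_sdiff, Projectivization.submodule_eq,
      Submodule.span_singleton_le_iff_mem, mem_annihilator_span, Set.mem_singleton_iff, forall_eq,
      Set.mem_insert_iff, forall_eq_or_imp]
    tauto
  rw [hset, Set.ncard_sdiff, ncard_submodule_le, ncard_submodule_le]
  · have h1 := finrank_annihilator (Submodule.span F {x})
    have h2 := finrank_annihilator (Submodule.span F {x, y})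
    rw [finrank_span_singleton hx] at h1
    have h3 : Module.finrank F (Submodule.span F {x, y}) = 2 := by
      have : LinearIndependent F ![x, y] := by
        rw [LinearIndependent.pair_iff' hx]
        exact fun a h => hy a h.symm
      have h4 := finrank_span_eq_card this
      rwa [Matrix.range_cons_cons_empty, Fintype.card_fin] at h4
    have h4 : Module.finrank F (annihilator (Submodule.span F {x})) = (n - 1) + 1 := by omega
    have h5 : Module.finrank F (annihilator (Submodule.span F {x, y})) = n - 1 := by omega
    rw [h4, h5, Finset.sum_range_succ, Nat.add_sub_cancel_left]
  · intro H
    simp only [Set.mem_ofPred_eq, Projectivization.submodule_eq,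
      Submodule.span_singleton_le_iff_mem, mem_annihilator_span, Set.mem_singleton_iff, forall_eq,
      Set.mem_insert_iff, forall_eq_or_imp]
    tauto

/-- Project the complement to points [x]. An eigenpoint has empty fibre, since ξx = 0 forces ξf(x) =
0; over any other point the fibre has q^(n-1) hyperplanes. -/
theorem ncard_compl_arisingHyperplane [Finite F] (hn : 1 ≤ n) (σ : F ≃+* F)
    (M : Matrix (Fin (n + 1)) (Fin (n + 1)) F) :
    (arisingHyperplane σ M)ᶜ.ncard =
      Nat.card F ^ (n - 1) * (eigenpoints (twistedMap σ M))ᶜ.ncard := by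
  have hgood : ∀ p : PG F n, p ∉ eigenpoints (twistedMap σ M) ↔
      ∀ a : F, twistedMap σ M p.rep ≠ a • p.rep := fun p => by
    rw [← not_exists, ← mk_mem_eigenpoints p.rep_nonzero, p.mk_rep]
  let A : PG F n → Set (DualPG F n) := fun p =>
    {H | H.rep ⬝ᵥ p.rep = 0 ∧ H.rep ⬝ᵥ twistedMap σ M p.rep ≠ 0}
  let e : ((arisingHyperplane σ M)ᶜ : Set (PHPoint F n)) ≃
      Σ p : ((eigenpoints (twistedMap σ M))ᶜ : Set (PG F n)), A p :=
    { toFun := fun P => ⟨⟨P.1.pt, (hgood _).2 fun a ha => P.2 (by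
          rw [mem_arisingHyperplane, ha, dotProduct_smul, incident_iff_rep.1 P.1.incident,
            smul_zero])⟩,
        ⟨P.1.hyp, incident_iff_rep.1 P.1.incident, fun h => P.2 (mem_arisingHyperplane.2 h)⟩⟩
      invFun := fun Q => ⟨⟨Q.1.1, Q.2.1, incident_iff_rep.2 Q.2.2.1⟩,
        fun h => Q.2.2.2 (mem_arisingHyperplane.1 h)⟩
      left_inv := fun P => rfl
      right_inv := fun Q => rfl }
  have := Fintype.ofFinite ((eigenpoints (twistedMap σ M))ᶜ : Set (PG F n))
  rw [← Nat.card_coe_set_eq, Nat.card_congr e, Nat.card_sigma, Finset.sum_congr rfl fun p _ =>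
      (Nat.card_coe_set_eq _).trans (ncard_hyperplanes_not_mem hn p.1.rep_nonzero
        ((hgood _).1 p.2)), Finset.sum_const, Finset.card_univ, smul_eq_mul, mul_comm,
    ← Nat.card_eq_fintype_card, Nat.card_coe_set_eq]

theorem weight_codeword_eq_mul [Finite F] (hn : 1 ≤ n) {σ : F ≃+* F}
    {X : projectiveSystem n σ → Matrix (Fin (n + 1)) (Fin (n + 1)) F} (hX : IsRepresentatives X)
    (M : Matrix (Fin (n + 1)) (Fin (n + 1)) F) :
    weight (codeword X M) = Nat.card F ^ (n - 1) * (eigenpoints (twistedMap σ M))ᶜ.ncard := by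
  rw [weight_codeword hX, ncard_compl_arisingHyperplane hn]

theorem ncard_eigenpoints_add_ncard_compl [Finite F] (σ : F ≃+* F)
    (M : Matrix (Fin (n + 1)) (Fin (n + 1)) F) :
    (eigenpoints (twistedMap σ M)).ncard + (eigenpoints (twistedMap σ M))ᶜ.ncard =
      ∑ i ∈ Finset.range (n + 1), Nat.card F ^ i := by
  rw [Set.ncard_add_ncard_compl, Projectivization.card_of_finrank F _ (Module.finrank_fin_fun F)]

end WeightFormula

/-! ### Counting the eigenpoints of a semilinear map -/

section Eigenpoints

variable {F : Type*} [Field F] {V : Type*} [AddCommGroup V] [Module F V]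

/-- Dividing all solutions by one non-zero solution puts them in the fixed field. -/
theorem ncard_semilinear_eigen_le [Finite F] (σ : F ≃+* F) {c d : F} (hc : c ≠ 0) (hd : d ≠ 0) :
    {a : F | σ a * d = c * a}.ncard ≤ Nat.card {a : F // σ a = a} := by
  by_cases h : ∃ b : F, b ≠ 0 ∧ σ b * d = c * b
  · obtain ⟨b, hb0, hb⟩ := h
    change _ ≤ {a : F | σ a = a}.ncard
    refine Set.ncard_le_ncard_of_injOn (fun a => a / b) (fun a ha => ?_)
      (fun a _ a' _ h => by simpa [div_left_inj' hb0] using h)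
    have ha' : σ a * d = c * a := ha
    have hσb : σ b ≠ 0 := by simpa using hb0
    change σ (a / b) = a / b
    rw [map_div₀, div_eq_div_iff hσb hb0]
    apply mul_left_cancel₀ (mul_ne_zero hc hd)
    linear_combination (c * b) * ha' - c * a * hb
  · push Not at h
    have h1 : {a : F | σ a * d = c * a} ⊆ {0} := fun a ha => by
      by_contra h0
      exact h a h0 ha
    have h2 := two_le_card_fixed σ
    have h3 := Set.ncard_le_ncard h1
    rw [Set.ncard_singleton] at h3
    omega

/-- The possible `j`-th coordinates of an eigenvector whose first non-zero coordinate, the `i`-th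
one, is `1`, with respect to independent eigenvectors with eigenvalues `l`. -/
def coordinateSet (σ : F ≃+* F) {r : ℕ} (l : Fin r → F) (i j : Fin r) : Set F :=
  if j < i then {0} else if j = i then {1} else {a : F | σ a * l j = l i * a}

theorem ncard_coordinateSet_of_le (σ : F ≃+* F) {r : ℕ} (l : Fin r → F) {i j : Fin r}
    (h : j ≤ i) : (coordinateSet σ l i j).ncard = 1 := by
  unfold coordinateSet
  split_ifs with h1 h2
  · exact Set.ncard_singleton _
  · exact Set.ncard_singleton _
  · exact absurd (lt_of_le_of_ne h h2) h1

theorem coordinateSet_of_lt (σ : F ≃+* F) {r : ℕ} (l : Fin r → F) {i j : Fin r} (h : i < j) :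
    coordinateSet σ l i j = {a : F | σ a * l j = l i * a} := by
  rw [coordinateSet, if_neg h.not_gt, if_neg h.ne']

/-- The number of eigenpoints, not in the kernel, of a semilinear map, in terms of a maximal
family of independent eigenvectors. -/
theorem ncard_eigenpoints_not_le_ker_le [Finite F] {σ : F ≃+* F} (f : V →ₛₗ[(σ : F →+* F)] V)
    {r : ℕ}
    {x : Fin r → V} {l : Fin r → F} (hx : LinearIndependent F x)
    (hf : ∀ i, f (x i) = l i • x i)
    (hspan : ∀ (v : V) (a : F), a ≠ 0 → f v = a • v → v ∈ Submodule.span F (Set.range x)) :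
    {p : ℙ F V | p ∈ eigenpoints f ∧ ¬ p.submodule ≤ LinearMap.ker f}.ncard ≤
      ∑ i, ∏ j, (coordinateSet σ l i j).ncard := by
  classical
  have := Fintype.ofFinite F
  let T : Finset (Fin r → F) :=
    Finset.univ.biUnion fun i => Fintype.piFinset fun j => (coordinateSet σ l i j).toFinset
  have hT : T.card ≤ ∑ i, ∏ j, (coordinateSet σ l i j).ncard := by
    refine Finset.card_biUnion_le.trans (le_of_eq ?_)
    refine Finset.sum_congr rfl fun i _ => ?_
    rw [Fintype.card_piFinset]
    exact Finset.prod_congr rfl fun j _ => (Set.ncard_eq_toFinset_card' _).symm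
  -- Points are replaced by their lines in V, so that spans can be written down without proofs that
  -- a vector is non-zero.
  rw [← Set.ncard_image_of_injective _ Projectivization.submodule_injective]
  have hsub : Projectivization.submodule ''
      {p : ℙ F V | p ∈ eigenpoints f ∧ ¬ p.submodule ≤ LinearMap.ker f} ⊆
      ((T.image fun a => Submodule.span F {∑ i, a i • x i} : Finset (Submodule F V)) :
        Set (Submodule F V)) := by
    rintro _ ⟨p, ⟨hp, hk⟩, rfl⟩
    induction p with | h v hv =>
    obtain ⟨c, hc⟩ := (mk_mem_eigenpoints hv).1 hp
    rw [Projectivization.submodule_mk, Submodule.span_singleton_le_iff_mem, LinearMap.mem_ker] at hk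
    have hc0 : c ≠ 0 := fun h => hk (by rw [hc, h, zero_smul])
    obtain ⟨a, rfl⟩ := (Submodule.mem_span_range_iff_exists_fun F).1 (hspan v c hc0 hc)
    -- Compare coefficients in f(v) = c v. Scaling the first non-zero coordinate to 1 then makes the
    -- eigenvalue equal to the corresponding `l i`.
    have hcoord : ∀ i, σ (a i) * l i = c * a i := by
      have h1 : ∑ i, (σ (a i) * l i - c * a i) • x i = 0 := by
        simp only [sub_smul, Finset.sum_sub_distrib, mul_smul, ← Finset.smul_sum, ← hc, map_sum,
          map_smulₛₗ, hf]
        simp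
      intro i
      exact sub_eq_zero.1 (Fintype.linearIndependent_iff.1 hx _ h1 i)
    have hne : ∃ i, a i ≠ 0 := by
      by_contra! h
      exact hv (by simp [h])
    obtain ⟨i, hi, hmin⟩ := WellFounded.has_min (wellFounded_lt (α := Fin r)) {i | a i ≠ 0} hne
    have hi0 : a i ≠ 0 := hi
    simp only [Finset.coe_image, Set.mem_image, Finset.mem_coe]
    refine ⟨fun j => (a i)⁻¹ * a j, ?_, ?_⟩
    · simp only [T, Finset.mem_biUnion, Finset.mem_univ, true_and, Fintype.mem_piFinset,
        Set.mem_toFinset]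
      refine ⟨i, fun j => ?_⟩
      unfold coordinateSet
      split_ifs with h1 h2
      · have : a j = 0 := by
          by_contra h
          exact hmin j h h1
        simp [this]
      · simp [h2, hi0]
      · have hσ : σ (a i) ≠ 0 := by simpa using hi0
        change σ ((a i)⁻¹ * a j) * l j = l i * ((a i)⁻¹ * a j)
        rw [map_mul, map_inv₀]
        field_simp
        linear_combination a i * hcoord j - a j * hcoord i
    · rw [Projectivization.submodule_mk]
      simp only [mul_smul, ← Finset.smul_sum]
      exact Submodule.span_singleton_smul_eq (IsUnit.mk0 _ (inv_ne_zero hi0)) _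
  refine (Set.ncard_le_ncard hsub (Finset.finite_toSet _)).trans ?_
  rw [Set.ncard_coe_finset]
  exact Finset.card_image_le.trans hT

/-- Only the r-1-i coordinates after the leading one are free, each with at most s values. -/
theorem sum_prod_ncard_coordinateSet_le [Finite F] (σ : F ≃+* F) {r : ℕ} {l : Fin r → F}
    (hl : ∀ i, l i ≠ 0) :
    ∑ i, ∏ j, (coordinateSet σ l i j).ncard ≤
      ∑ i ∈ Finset.range r, Nat.card {a : F // σ a = a} ^ i := by
  rw [← Finset.sum_range_reflect, ← Fin.sum_univ_eq_sum_range
    (fun i => Nat.card {a : F // σ a = a} ^ (r - 1 - i))]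
  refine Finset.sum_le_sum fun i _ => ?_
  calc ∏ j, (coordinateSet σ l i j).ncard
      ≤ ∏ j, if j ∈ Finset.Ioi i then Nat.card {a : F // σ a = a} else 1 := by
        refine Finset.prod_le_prod' fun j _ => ?_
        split_ifs with h
        · rw [coordinateSet_of_lt σ l (Finset.mem_Ioi.1 h)]
          exact ncard_semilinear_eigen_le σ (hl i) (hl j)
        · rw [ncard_coordinateSet_of_le σ l (le_of_not_gt fun h' => h (Finset.mem_Ioi.2 h'))]
    _ = _ := by
        rw [Finset.prod_ite_mem, Finset.univ_inter, Finset.prod_const, Fin.card_Ioi]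

/-- A maximal independent family of eigenvectors with non-zero eigenvalues. -/
theorem exists_independent_eigenvectors [FiniteDimensional F V] {σ : F ≃+* F}
    (f : V →ₛₗ[(σ : F →+* F)] V) :
    ∃ (r : ℕ) (x : Fin r → V) (l : Fin r → F), LinearIndependent F x ∧ (∀ i, l i ≠ 0) ∧
      (∀ i, f (x i) = l i • x i) ∧
      (∀ (v : V) (a : F), a ≠ 0 → f v = a • v → v ∈ Submodule.span F (Set.range x)) ∧
      r + Module.finrank F (LinearMap.ker f) ≤ Module.finrank F V := by
  obtain ⟨b, hbE, hspan, hb⟩ :=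
    exists_linearIndependent F {v : V | ∃ a : F, a ≠ 0 ∧ f v = a • v}
  have hfin : Finite b := hb.finite
  have := Fintype.ofFinite b
  let e := (Finite.equivFin b).symm
  have hx : LinearIndependent F fun i => (e i : V) := hb.comp e e.injective
  have hrange : Set.range (fun i => (e i : V)) = b := by
    rw [Set.range_comp' Subtype.val e, e.range_eq_univ, Set.image_univ, Subtype.range_coe]
  choose l hl hf using fun i => hbE (e i).2
  refine ⟨Nat.card b, fun i => e i, l, hx, hl, hf, fun v a ha hv => ?_, ?_⟩
  · rw [hrange, hspan]
    exact Submodule.subset_span ⟨a, ha, hv⟩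
  -- On the span, f acts on coordinates by a_i ↦ σ(a_i) l_i with l_i ≠ 0, hence injectively.
  · have hdis : Disjoint (Submodule.span F (Set.range fun i => (e i : V))) (LinearMap.ker f) := by
      rw [Submodule.disjoint_def]
      intro v hv hk
      obtain ⟨a, rfl⟩ := (Submodule.mem_span_range_iff_exists_fun F).1 hv
      rw [LinearMap.mem_ker, map_sum] at hk
      have h1 : ∑ i, (σ (a i) * l i) • (e i : V) = 0 := by
        rw [← hk]
        refine Finset.sum_congr rfl fun i _ => ?_
        rw [map_smulₛₗ, hf, mul_smul]
        rfl
      have h2 := Fintype.linearIndependent_iff.1 hx _ h1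
      have h3 : ∀ i, a i = 0 := fun i => by
        simpa [hl i] using h2 i
      exact Finset.sum_eq_zero fun i _ => by rw [h3 i, zero_smul]
    have h4 := Submodule.finrank_add_finrank_le_of_disjoint hdis
    rwa [finrank_span_eq_card hx, Fintype.card_fin] at h4

theorem ncard_eigenpoints_le [Finite F] {σ : F ≃+* F} [Finite V] (f : V →ₛₗ[(σ : F →+* F)] V) :
    (eigenpoints f).ncard ≤
      ∑ i ∈ Finset.range (Module.finrank F (LinearMap.ker f)), Nat.card F ^ i +
        {p : ℙ F V | p ∈ eigenpoints f ∧ ¬ p.submodule ≤ LinearMap.ker f}.ncard := by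
  rw [← ncard_submodule_le]
  refine le_trans (Set.ncard_le_ncard fun p hp => ?_) (Set.ncard_union_le _ _)
  by_cases h : p.submodule ≤ LinearMap.ker f
  · exact Or.inl h
  · exact Or.inr ⟨hp, h⟩

theorem ncard_eigenpoints_le_sum_add_sum [Finite F] {σ : F ≃+* F} [Finite V]
    (f : V →ₛₗ[(σ : F →+* F)] V) :
    (eigenpoints f).ncard ≤
      ∑ i ∈ Finset.range (Module.finrank F (LinearMap.ker f)), Nat.card F ^ i +
        ∑ i ∈ Finset.range (Module.finrank F V - Module.finrank F (LinearMap.ker f)),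
          Nat.card {a : F // σ a = a} ^ i := by
  have := Module.Finite.of_finite (R := F) (M := V)
  obtain ⟨r, x, l, hx, hl, hf, hspan, hr⟩ := exists_independent_eigenvectors f
  refine (ncard_eigenpoints_le f).trans (Nat.add_le_add_left ?_ _)
  refine (ncard_eigenpoints_not_le_ker_le f hx hf hspan).trans ?_
  refine (sum_prod_ncard_coordinateSet_le σ hl).trans ?_
  exact Finset.sum_le_sum_of_subset (Finset.range_subset_range.2 (by omega))

end Eigenpoints

/-! ### Matrices of rank one and the low weights -/

section LowWeights

variable {F : Type*} [Field F] {n : ℕ}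

theorem twistedMap_single (σ : F ≃+* F) (M : Matrix (Fin (n + 1)) (Fin (n + 1)) F)
    (i j : Fin (n + 1)) : twistedMap σ M (Pi.single j 1) i = M i j := by
  have h : (fun k => σ ((Pi.single j 1 : Fin (n + 1) → F) k)) = Pi.single j 1 := by
    ext k
    by_cases hk : k = j
    · subst hk; simp
    · simp [hk]
  rw [twistedMap_apply, h, Matrix.mulVec_single_one]
  rfl

/-- Twisting the row factor makes the kernel the hyperplane [b] itself rather than its conjugate. -/
theorem twistedMap_vecMulVec (σ : F ≃+* F) (a b x : Fin (n + 1) → F) :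
    twistedMap σ (Matrix.vecMulVec a fun i => σ (b i)) x = σ (b ⬝ᵥ x) • a := by
  rw [twistedMap_apply, Matrix.vecMulVec_mulVec, op_smul_eq_smul]
  simp [dotProduct, map_sum]

theorem vecMulVec_twist_ne_zero (σ : F ≃+* F) {a b : Fin (n + 1) → F} (ha : a ≠ 0) (hb : b ≠ 0) :
    Matrix.vecMulVec a (fun i => σ (b i)) ≠ 0 := by
  obtain ⟨i, hi⟩ := Function.ne_iff.1 ha
  obtain ⟨j, hj⟩ := Function.ne_iff.1 hb
  intro h
  have := congrFun (congrFun h i) j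
  simp only [Matrix.vecMulVec_apply, Matrix.zero_apply, mul_eq_zero,
    EmbeddingLike.map_eq_zero_iff] at this
  exact this.elim hi hj

/-- The image lies in ⟨a⟩, so an eigenvector outside the kernel is a multiple of a. The point [a] is
new exactly when b·a ≠ 0, which separates the two lowest weights. -/
theorem eigenpoints_vecMulVec (σ : F ≃+* F) {a b : Fin (n + 1) → F} (ha : a ≠ 0) :
    eigenpoints (twistedMap σ (Matrix.vecMulVec a fun i => σ (b i))) =
      insert (Projectivization.mk F a ha)
        {p : PG F n | p.submodule ≤ annihilator (Submodule.span F {b})} := by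
  ext p
  induction p with | h x hx =>
  rw [mk_mem_eigenpoints, twistedMap_vecMulVec, Set.mem_insert_iff, Set.mem_ofPred_eq,
    Projectivization.submodule_mk, Submodule.span_singleton_le_iff_mem, mem_annihilator_span,
    Projectivization.mk_eq_mk_iff']
  simp only [Set.mem_singleton_iff, forall_eq, dotProduct_comm x b]
  constructor
  · rintro ⟨c, hc⟩
    by_cases h0 : b ⬝ᵥ x = 0
    · exact Or.inr h0
    · left
      have h1 : σ (b ⬝ᵥ x) ≠ 0 := by simpa using h0
      have hc0 : c ≠ 0 := by
        rintro rfl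
        rw [zero_smul, smul_eq_zero] at hc
        exact hc.elim h1 ha
      exact ⟨c⁻¹ * σ (b ⬝ᵥ x), by rw [mul_smul, hc, inv_smul_smul₀ hc0]⟩
  · rintro (⟨c, rfl⟩ | h)
    · have hc0 : c ≠ 0 := by
        rintro rfl
        exact hx (zero_smul F a)
      exact ⟨σ (b ⬝ᵥ c • a) * c⁻¹, by rw [mul_smul, inv_smul_smul₀ hc0]⟩
    · exact ⟨0, by rw [h, map_zero, zero_smul, zero_smul]⟩

theorem finrank_annihilator_singleton {b : Fin (n + 1) → F} (hb : b ≠ 0) :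
    Module.finrank F (annihilator (Submodule.span F {b})) = n := by
  have h1 := finrank_annihilator (Submodule.span F {b})
  rw [finrank_span_singleton hb] at h1
  omega

theorem ncard_compl_eigenpoints_vecMulVec_of_eq_zero [Finite F] (σ : F ≃+* F)
    {a b : Fin (n + 1) → F} (ha : a ≠ 0) (hb : b ≠ 0) (hab : b ⬝ᵥ a = 0) :
    (eigenpoints (twistedMap σ (Matrix.vecMulVec a fun i => σ (b i))))ᶜ.ncard =
      Nat.card F ^ n := by
  have h := ncard_eigenpoints_add_ncard_compl σ (Matrix.vecMulVec a fun i => σ (b i))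
  have h2 := congrArg Set.ncard (eigenpoints_vecMulVec σ (b := b) ha)
  rw [Set.insert_eq_of_mem, ncard_submodule_le, finrank_annihilator_singleton hb] at h2
  · rw [h2, Finset.sum_range_succ] at h
    omega
  · rw [Set.mem_ofPred_eq, Projectivization.submodule_mk, Submodule.span_singleton_le_iff_mem,
      mem_annihilator_span]
    simpa [dotProduct_comm] using hab

theorem ncard_compl_eigenpoints_vecMulVec_of_ne_zero [Finite F] (σ : F ≃+* F)
    {a b : Fin (n + 1) → F} (ha : a ≠ 0) (hb : b ≠ 0) (hab : b ⬝ᵥ a ≠ 0) :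
    (eigenpoints (twistedMap σ (Matrix.vecMulVec a fun i => σ (b i))))ᶜ.ncard + 1 =
      Nat.card F ^ n := by
  have h := ncard_eigenpoints_add_ncard_compl σ (Matrix.vecMulVec a fun i => σ (b i))
  have h2 := congrArg Set.ncard (eigenpoints_vecMulVec σ (b := b) ha)
  rw [Set.ncard_insert_of_notMem, ncard_submodule_le, finrank_annihilator_singleton hb] at h2
  · rw [h2, Finset.sum_range_succ] at h
    omega
  · rw [Set.mem_ofPred_eq, Projectivization.submodule_mk, Submodule.span_singleton_le_iff_mem,
      mem_annihilator_span]
    simpa [dotProduct_comm] using hab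

/-- A matrix whose semilinear map has a kernel of codimension at most one has rank one. -/
theorem exists_eq_vecMulVec_of_le_finrank_ker (σ : F ≃+* F)
    {M : Matrix (Fin (n + 1)) (Fin (n + 1)) F} (hM : M ≠ 0)
    (h : n ≤ Module.finrank F (LinearMap.ker (twistedMap σ M))) :
    ∃ a b : Fin (n + 1) → F, a ≠ 0 ∧ b ≠ 0 ∧ M = Matrix.vecMulVec a fun i => σ (b i) := by
  have hex : ∃ x, twistedMap σ M x ≠ 0 := by
    by_contra! h0
    apply hM
    ext i j
    have h1 := congrFun (h0 (Pi.single j 1)) i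
    rwa [twistedMap_single] at h1
  obtain ⟨x, hx⟩ := hex
  obtain ⟨b, hb, hbx⟩ := exists_dotProduct_ne_zero (U := LinearMap.ker (twistedMap σ M)) (y := x) hx
  have hb0 : b ≠ 0 := fun h0 => hbx (by rw [h0, zero_dotProduct])
  have hle : LinearMap.ker (twistedMap σ M) ≤ annihilator (Submodule.span F {b}) := by
    intro y hy
    rw [mem_annihilator_span]
    rintro _ rfl
    rw [dotProduct_comm]
    exact hb y hy
  have hker : annihilator (Submodule.span F {b}) = LinearMap.ker (twistedMap σ M) :=
    (Submodule.eq_of_le_of_finrank_le hle (by rwa [finrank_annihilator_singleton hb0])).symm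
  refine ⟨σ (b ⬝ᵥ x)⁻¹ • twistedMap σ M x, b, ?_, hb0, ?_⟩
  · exact smul_ne_zero (by simpa using hbx) hx
  · have key : ∀ y, twistedMap σ M y =
        twistedMap σ (Matrix.vecMulVec (σ (b ⬝ᵥ x)⁻¹ • twistedMap σ M x) fun i => σ (b i)) y := by
      intro y
      -- Decompose y along x and the kernel b^⊥; only the component along x survives.
      have h1 : y - (b ⬝ᵥ y * (b ⬝ᵥ x)⁻¹) • x ∈ LinearMap.ker (twistedMap σ M) := by
        rw [← hker, mem_annihilator_span]
        rintro _ rfl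
        rw [dotProduct_comm, dotProduct_sub, dotProduct_smul, smul_eq_mul,
          inv_mul_cancel_right₀ hbx, sub_self]
      rw [LinearMap.mem_ker, map_sub, sub_eq_zero, map_smulₛₗ] at h1
      rw [h1, twistedMap_vecMulVec, smul_smul, ← map_mul]
      rfl
    ext i j
    have h1 := congrFun (key (Pi.single j 1)) i
    rwa [twistedMap_single, twistedMap_single] at h1

/-- Here d is the kernel dimension and n = d + k + 1. After cancelling d terms, k+2 powers of s face
k+1 powers of q ≥ s² starting at q^d. For d = 0, k = 1, q = s² the inequality fails, since 1+s+s² >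
1+s²; the last hypothesis removes this case. -/
theorem sum_pow_add_sum_pow_lt {q s d k : ℕ} (hs : 2 ≤ s) (hq : s ^ 2 ≤ q) (hdk : 1 ≤ d + k)
    (h : 2 ≤ d + k ∨ s ^ 3 ≤ q) :
    ∑ i ∈ Finset.range d, q ^ i + ∑ i ∈ Finset.range (k + 2), s ^ i <
      ∑ i ∈ Finset.range (d + k + 1), q ^ i := by
  rw [show d + k + 1 = d + (k + 1) by omega, Finset.sum_range_add _ d (k + 1),
    Nat.add_lt_add_iff_left]
  have hsq : s ≤ q := by nlinarith
  have hq0 : 1 ≤ q := by omega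
  have h1s : 1 + s < s ^ 2 := by nlinarith
  rcases Nat.eq_zero_or_pos d with rfl | hd
  · simp only [zero_add]
    have step : ∀ k, s ^ (k + 2) ≤ q ^ (k + 1) := fun k =>
      calc s ^ (k + 2) ≤ s ^ (2 * (k + 1)) := Nat.pow_le_pow_right (by omega) (by omega)
        _ = (s ^ 2) ^ (k + 1) := pow_mul s 2 (k + 1)
        _ ≤ q ^ (k + 1) := Nat.pow_le_pow_left hq _
    -- The inequality propagates upwards because s^(k+2) ≤ q^(k+1). It starts at k = 2 when only q ≥
    -- s² is known, and at k = 1 when q ≥ s³.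
    have up : ∀ k₀, ∑ i ∈ Finset.range (k₀ + 2), s ^ i < ∑ i ∈ Finset.range (k₀ + 1), q ^ i →
        ∀ k, k₀ ≤ k → ∑ i ∈ Finset.range (k + 2), s ^ i < ∑ i ∈ Finset.range (k + 1), q ^ i := by
      intro k₀ h0 k hk
      induction k, hk using Nat.le_induction with
      | base => exact h0
      | succ k _ ih =>
        rw [show k + 1 + 2 = k + 2 + 1 from rfl, Finset.sum_range_succ (fun i => s ^ i) (k + 2),
          Finset.sum_range_succ (fun i => q ^ i) (k + 1)]
        exact add_lt_add_of_lt_of_le ih (step k)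
    rcases h with h | h
    · refine up 2 ?_ k (by omega)
      simp only [Finset.sum_range_succ, Finset.sum_range_zero, zero_add, pow_zero, pow_one,
        Nat.reduceAdd]
      have h4 : s ^ 4 ≤ q ^ 2 := by
        calc s ^ 4 = (s ^ 2) ^ 2 := by ring
          _ ≤ q ^ 2 := Nat.pow_le_pow_left hq 2
      have h5 : s ^ 3 * 2 ≤ s ^ 4 := by
        rw [pow_succ s 3]
        exact Nat.mul_le_mul_left _ hs
      have h6 : s < s ^ 3 := by
        calc s < s ^ 2 := by omega
          _ ≤ s ^ 3 := Nat.pow_le_pow_right (by omega) (by omega)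
      omega
    · refine up 1 ?_ k (by omega)
      simp only [Finset.sum_range_succ, Finset.sum_range_zero, zero_add, pow_zero, pow_one,
        Nat.reduceAdd]
      have h5 : s ^ 2 * 2 ≤ s ^ 3 := by
        rw [pow_succ s 2]
        exact Nat.mul_le_mul_left _ hs
      omega
  · clear h hdk
    induction k with
    | zero =>
      simp only [Finset.sum_range_succ, Finset.sum_range_zero, zero_add, pow_zero, pow_one,
        add_zero]
      calc 1 + s < q := by omega
        _ ≤ q ^ d := Nat.le_self_pow (by omega) q
    | succ k ih =>
      rw [show k + 1 + 2 = k + 2 + 1 from rfl, Finset.sum_range_succ (fun i => s ^ i) (k + 2),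
        Finset.sum_range_succ (fun i => q ^ (d + i)) (k + 1)]
      refine add_lt_add_of_lt_of_le ih ?_
      calc s ^ (k + 2) ≤ q ^ (k + 2) := Nat.pow_le_pow_left hsq _
        _ ≤ q ^ (d + (k + 1)) := Nat.pow_le_pow_right hq0 (by omega)

/-- The matrices of rank at least two have a semilinear map with few eigenpoints. -/
theorem card_pow_lt_ncard_compl_eigenpoints [Finite F] {σ : F ≃+* F} (hσ : σ ≠ 1) (hn : 2 ≤ n)
    (M : Matrix (Fin (n + 1)) (Fin (n + 1)) F)
    (hd : Module.finrank F (LinearMap.ker (twistedMap σ M)) < n)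
    (h : 2 < n ∨ σ ^ 2 ≠ 1) :
    Nat.card F ^ n < (eigenpoints (twistedMap σ M))ᶜ.ncard := by
  have h1 := ncard_eigenpoints_le_sum_add_sum (twistedMap σ M)
  have h2 := ncard_eigenpoints_add_ncard_compl σ M
  rw [Module.finrank_fin_fun] at h1
  set d := Module.finrank F (LinearMap.ker (twistedMap σ M))
  obtain ⟨k, hk⟩ : ∃ k, n = d + k + 1 := ⟨n - d - 1, by omega⟩
  have h3 := sum_pow_add_sum_pow_lt (d := d) (k := k) (two_le_card_fixed σ) (card_fixed_sq_le hσ)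
    (by omega) (h.imp (by omega) (card_fixed_cube_le hσ))
  rw [show n + 1 - d = k + 2 by omega] at h1
  rw [Finset.sum_range_succ] at h2
  rw [← hk] at h3
  omega

end LowWeights

/-! ### Quasi-singular hyperplanes -/

section QuasiSingular

variable {F : Type*} [Field F] {n : ℕ}

/-- Used to complete degenerate configurations, such as coinciding points or hyperplanes, to actual
lines of the geometry. -/
theorem exists_submodule_between {V : Type*} [AddCommGroup V] [Module F V] [FiniteDimensional F V]
    {U W : Submodule F V} (hUW : U ≤ W) {k : ℕ} (hU : Module.finrank F U ≤ k)
    (hW : k ≤ Module.finrank F W) :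
    ∃ S : Submodule F V, U ≤ S ∧ S ≤ W ∧ Module.finrank F S = k := by
  induction k, hU using Nat.le_induction with
  | base => exact ⟨U, le_rfl, hUW, rfl⟩
  | succ k _ ih =>
    obtain ⟨S, h1, h2, h3⟩ := ih (by omega)
    obtain ⟨v, hvW, hvS⟩ : ∃ v ∈ W, v ∉ S := by
      by_contra! h
      have := Submodule.finrank_mono (show W ≤ S from h)
      omega
    refine ⟨S ⊔ Submodule.span F {v}, h1.trans le_sup_left,
      sup_le h2 ((Submodule.span_singleton_le_iff_mem v W).2 hvW), ?_⟩
    have hlt : S < S ⊔ Submodule.span F {v} := by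
      refine lt_of_le_of_ne le_sup_left fun h => hvS ?_
      rw [h]
      exact Submodule.mem_sup_right (Submodule.mem_span_singleton_self v)
    have h4 := Submodule.finrank_lt_finrank_of_lt hlt
    have h5 := Submodule.finrank_add_le_finrank_add_finrank S (Submodule.span F {v})
    have h6 : Module.finrank F (Submodule.span F {v}) ≤ 1 := by
      have := finrank_span_finset_le_card (R := F) ({v} : Finset V)
      rwa [Finset.coe_singleton, Finset.card_singleton] at this
    omega

theorem hyperplane_eq_annihilator (H : DualPG F n) :
    hyperplane H = annihilator (Submodule.span F {H.rep}) := by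
  ext x
  rw [mem_annihilator_span]
  simp [hyperplane, dotProduct_comm]

theorem submodule_le_hyperplane {p : PG F n} {H : DualPG F n} :
    p.submodule ≤ hyperplane H ↔ Incident p H := by
  rw [Projectivization.submodule_eq, Submodule.span_singleton_le_iff_mem, incident_iff_rep]
  rfl

theorem finrank_hyperplane (H : DualPG F n) : Module.finrank F (hyperplane H) = n := by
  rw [hyperplane_eq_annihilator, finrank_annihilator_singleton H.rep_nonzero]

theorem le_finrank_hyperplane_inf (H K : DualPG F n) :
    n - 1 ≤ Module.finrank F (hyperplane H ⊓ hyperplane K : Submodule F (Fin (n + 1) → F)) := by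
  have h1 := Submodule.finrank_sup_add_finrank_inf_eq (hyperplane H) (hyperplane K)
  have h2 := Submodule.finrank_le (hyperplane H ⊔ hyperplane K)
  rw [finrank_hyperplane, finrank_hyperplane] at h1
  rw [Module.finrank_fin_fun] at h2
  omega

/-- Points on a common line share their hyperplane or their point. Conversely, n ≥ 2 leaves room for
a line inside P.hyp through P.pt and p, or dually for a codimension-2 subspace inside P.hyp ∩ A
through P.pt. -/
theorem mem_quasiSingular (hn : 2 ≤ n) {p : PG F n} {A : DualPG F n} {P : PHPoint F n} :
    P ∈ quasiSingular p A ↔ Incident p P.hyp ∨ Incident P.pt A := by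
  constructor
  · rintro ⟨Q, hQ, l, ⟨r, H, -, -, rfl⟩ | ⟨x, S, -, -, rfl⟩, hP, hQl⟩
    · have h : P.hyp = Q.hyp := hP.1.trans hQl.1.symm
      rcases hQ with rfl | rfl
      · left
        rw [h]
        exact Q.incident
      · right
        rw [← h]
        exact P.incident
    · have h : P.pt = Q.pt := hP.1.trans hQl.1.symm
      rcases hQ with rfl | rfl
      · left
        rw [← h]
        exact P.incident
      · right
        rw [h]
        exact Q.incident
  · rintro (h | h)
    · obtain ⟨r, h1, h2, h3⟩ := exists_submodule_between (k := 2)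
        (sup_le (submodule_le_hyperplane.2 P.incident) (submodule_le_hyperplane.2 h))
        ((Submodule.finrank_add_le_finrank_add_finrank _ _).trans (by
          rw [Projectivization.finrank_submodule, Projectivization.finrank_submodule]))
        (by rwa [finrank_hyperplane])
      exact ⟨⟨p, P.hyp, h⟩, Or.inl rfl, {R | R.hyp = P.hyp ∧ R.pt.submodule ≤ r},
        Or.inl ⟨r, P.hyp, h3, h2, rfl⟩, ⟨rfl, le_sup_left.trans h1⟩, ⟨rfl, le_sup_right.trans h1⟩⟩
    · obtain ⟨S, h1, h2, h3⟩ := exists_submodule_between (k := n - 1)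
        (le_inf (submodule_le_hyperplane.2 P.incident) (submodule_le_hyperplane.2 h))
        (by rw [Projectivization.finrank_submodule]; omega) (le_finrank_hyperplane_inf _ _)
      exact ⟨⟨P.pt, A, h⟩, Or.inr rfl, {R | R.pt = P.pt ∧ S ≤ hyperplane R.hyp},
        Or.inr ⟨P.pt, S, by omega, h1, rfl⟩, ⟨rfl, h2.trans inf_le_left⟩,
        ⟨rfl, h2.trans inf_le_right⟩⟩

/-- A quasi-singular hyperplane arises from a matrix of rank one. -/
theorem quasiSingular_mk_eq_arisingHyperplane (hn : 2 ≤ n) (σ : F ≃+* F)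
    {a b : Fin (n + 1) → F} (ha : a ≠ 0) (hb : b ≠ 0) :
    quasiSingular (Projectivization.mk F a ha) (Projectivization.mk F b hb) =
      arisingHyperplane σ (Matrix.vecMulVec a fun i => σ (b i)) := by
  ext ⟨p, H, h⟩
  induction p using Projectivization.ind with | h x hx =>
  induction H using Projectivization.ind with | h ξ hξ =>
  rw [mem_quasiSingular hn, mk_mem_arisingHyperplane, twistedMap_vecMulVec, dotProduct_smul,
    smul_eq_mul, mul_eq_zero, EmbeddingLike.map_eq_zero_iff, or_comm]
  rfl

theorem exists_eq_quasiSingular {p : PG F n} {A : DualPG F n} (hn : 2 ≤ n) (σ : F ≃+* F) :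
    ∃ a b : Fin (n + 1) → F, a ≠ 0 ∧ b ≠ 0 ∧ (Incident p A ↔ b ⬝ᵥ a = 0) ∧
      quasiSingular p A = arisingHyperplane σ (Matrix.vecMulVec a fun i => σ (b i)) := by
  induction p using Projectivization.ind with | h a ha =>
  induction A using Projectivization.ind with | h b hb =>
  exact ⟨a, b, ha, hb, Iff.rfl, quasiSingular_mk_eq_arisingHyperplane hn σ ha hb⟩

variable {σ : F ≃+* F} {X : projectiveSystem n σ → Matrix (Fin (n + 1)) (Fin (n + 1)) F}

theorem weight_codeword_eq_of_arisingHyperplane_eq (hX : IsRepresentatives X)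
    {M M' : Matrix (Fin (n + 1)) (Fin (n + 1)) F}
    (h : arisingHyperplane σ M = arisingHyperplane σ M') :
    weight (codeword X M) = weight (codeword X M') := by
  rw [weight_codeword hX, weight_codeword hX, h]

theorem weight_codeword_vecMulVec_of_eq_zero [Finite F] (hX : IsRepresentatives X) (hn : 2 ≤ n)
    {a b : Fin (n + 1) → F} (ha : a ≠ 0) (hb : b ≠ 0) (hab : b ⬝ᵥ a = 0) :
    weight (codeword X (Matrix.vecMulVec a fun i => σ (b i))) = Nat.card F ^ (2 * n - 1) := by
  rw [weight_codeword_eq_mul (by omega) hX,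
    ncard_compl_eigenpoints_vecMulVec_of_eq_zero σ ha hb hab, ← pow_add]
  congr 1
  omega

theorem weight_codeword_vecMulVec_of_ne_zero [Finite F] (hX : IsRepresentatives X) (hn : 2 ≤ n)
    {a b : Fin (n + 1) → F} (ha : a ≠ 0) (hb : b ≠ 0) (hab : b ⬝ᵥ a ≠ 0) :
    weight (codeword X (Matrix.vecMulVec a fun i => σ (b i))) =
      Nat.card F ^ (2 * n - 1) - Nat.card F ^ (n - 1) := by
  have h := ncard_compl_eigenpoints_vecMulVec_of_ne_zero σ ha hb hab
  rw [weight_codeword_eq_mul (by omega) hX, show 2 * n - 1 = (n - 1) + n by omega, pow_add, ← h,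
    mul_add, mul_one, Nat.add_sub_cancel]

theorem card_pow_lt_weight_codeword [Finite F] (hX : IsRepresentatives X) (hσ : σ ≠ 1) (hn : 2 ≤ n)
    (h : 2 < n ∨ σ ^ 2 ≠ 1) (M : Matrix (Fin (n + 1)) (Fin (n + 1)) F)
    (hd : Module.finrank F (LinearMap.ker (twistedMap σ M)) < n) :
    Nat.card F ^ (2 * n - 1) < weight (codeword X M) := by
  rw [weight_codeword_eq_mul (by omega) hX, show 2 * n - 1 = (n - 1) + n by omega, pow_add]
  exact Nat.mul_lt_mul_of_pos_left (card_pow_lt_ncard_compl_eigenpoints hσ hn M hd h)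
    (pow_pos Nat.card_pos _)

theorem codeword_zero : codeword X 0 = 0 := by
  ext p
  simp [codeword]

theorem ne_zero_of_weight_pos {ι : Type*} {c : ι → F} (h : 0 < weight c) : c ≠ 0 := by
  rintro rfl
  simp [weight] at h

/-- Positivity of the weights makes M ↦ c_M injective, so non-zero words and non-zero matrices
correspond. -/
theorem mem_weights_iff (hM : ∀ M, M ≠ 0 → 0 < weight (codeword X M)) {w : ℕ} :
    w ∈ weights (projectiveCode X) ↔ ∃ M, M ≠ 0 ∧ weight (codeword X M) = w := by
  constructor
  · rintro ⟨c, hc, hc0, rfl⟩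
    obtain ⟨M, rfl⟩ := mem_projectiveCode.1 hc
    refine ⟨M, ?_, rfl⟩
    rintro rfl
    exact hc0 codeword_zero
  · rintro ⟨M, h0, rfl⟩
    exact ⟨_, mem_projectiveCode.2 ⟨M, rfl⟩, ne_zero_of_weight_pos (hM M h0), rfl⟩

theorem isMinimumWeightCodeword_iff (hM : ∀ M, M ≠ 0 → 0 < weight (codeword X M)) {w : ℕ}
    (hw : IsLeast (weights (projectiveCode X)) w) {M : Matrix (Fin (n + 1)) (Fin (n + 1)) F}
    (h0 : M ≠ 0) :
    IsMinimumWeightCodeword (projectiveCode X) (codeword X M) ↔ weight (codeword X M) = w := by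
  constructor
  · rintro ⟨-, -, h⟩
    exact h.unique hw
  · intro h
    exact ⟨mem_projectiveCode.2 ⟨M, rfl⟩, ne_zero_of_weight_pos (hM M h0), h ▸ hw⟩

theorem isSecondLowestWeightCodeword_iff (hM : ∀ M, M ≠ 0 → 0 < weight (codeword X M)) {w : ℕ}
    (hw : IsLeast (nonMinimumWeights (projectiveCode X)) w)
    {M : Matrix (Fin (n + 1)) (Fin (n + 1)) F} (h0 : M ≠ 0) :
    IsSecondLowestWeightCodeword (projectiveCode X) (codeword X M) ↔
      weight (codeword X M) = w := by
  constructor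
  · rintro ⟨-, -, h⟩
    exact h.unique hw
  · intro h
    exact ⟨mem_projectiveCode.2 ⟨M, rfl⟩, ne_zero_of_weight_pos (hM M h0), h ▸ hw⟩

/-- The two lowest weights and the corresponding codewords, when the plane with an involutory
automorphism is excluded. -/
theorem low_weights [Finite F] (hX : IsRepresentatives X) (hσ : σ ≠ 1) (hn : 2 ≤ n)
    (h : 2 < n ∨ σ ^ 2 ≠ 1) :
    IsLeast (weights (projectiveCode X)) (Nat.card F ^ (2 * n - 1) - Nat.card F ^ (n - 1)) ∧
      IsLeast (nonMinimumWeights (projectiveCode X)) (Nat.card F ^ (2 * n - 1)) ∧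
      ∀ M : Matrix (Fin (n + 1)) (Fin (n + 1)) F, M ≠ 0 →
        (IsMinimumWeightCodeword (projectiveCode X) (codeword X M) ↔
          IsQuasiSingular (arisingHyperplane σ M) ∧ ¬ IsSingular (arisingHyperplane σ M)) ∧
        (IsSecondLowestWeightCodeword (projectiveCode X) (codeword X M) ↔
          IsSingular (arisingHyperplane σ M)) := by
  set q := Nat.card F with hq
  have hq4 : 4 ≤ q := four_le_card hσ
  have hlt : q ^ (n - 1) < q ^ (2 * n - 1) := Nat.pow_lt_pow_right (by omega) (by omega)
  have hpos : 0 < q ^ (n - 1) := pow_pos (by omega) _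
  have hcases : ∀ M : Matrix (Fin (n + 1)) (Fin (n + 1)) F, M ≠ 0 →
      (weight (codeword X M) = q ^ (2 * n - 1) - q ^ (n - 1) ∧
        ∃ p A, arisingHyperplane σ M = quasiSingular p A) ∨
      (weight (codeword X M) = q ^ (2 * n - 1) ∧ IsSingular (arisingHyperplane σ M)) ∨
      q ^ (2 * n - 1) < weight (codeword X M) := by
    intro M hM
    rcases lt_or_ge (Module.finrank F (LinearMap.ker (twistedMap σ M))) n with hd | hd
    · exact Or.inr (Or.inr (card_pow_lt_weight_codeword hX hσ hn h M hd))
    · obtain ⟨a, b, ha, hb, rfl⟩ := exists_eq_vecMulVec_of_le_finrank_ker σ hM hd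
      have hqs := quasiSingular_mk_eq_arisingHyperplane hn σ ha hb
      by_cases hab : b ⬝ᵥ a = 0
      · exact Or.inr (Or.inl ⟨weight_codeword_vecMulVec_of_eq_zero hX hn ha hb hab,
          Projectivization.mk F a ha, Projectivization.mk F b hb, hab, hqs.symm⟩)
      · exact Or.inl ⟨weight_codeword_vecMulVec_of_ne_zero hX hn ha hb hab, _, _, hqs.symm⟩
  have hMpos : ∀ M, M ≠ 0 → 0 < weight (codeword X M) := fun M hM => by
    rcases hcases M hM with ⟨h, -⟩ | ⟨h, -⟩ | h <;> omega
  have he0 : (Pi.single 0 1 : Fin (n + 1) → F) ≠ 0 := by simp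
  have he1 : (Pi.single 1 1 : Fin (n + 1) → F) ≠ 0 := by simp
  have h01 : (0 : Fin (n + 1)) ≠ 1 := by
    intro h
    have := congrArg Fin.val h
    rw [Fin.val_one', Fin.val_zero, Nat.mod_eq_of_lt (by omega)] at this
    omega
  have hmin : IsLeast (weights (projectiveCode X)) (q ^ (2 * n - 1) - q ^ (n - 1)) := by
    constructor
    · rw [mem_weights_iff hMpos]
      exact ⟨_, vecMulVec_twist_ne_zero σ he0 he0,
        weight_codeword_vecMulVec_of_ne_zero hX hn he0 he0 (by simp)⟩
    · intro w hw
      obtain ⟨M, hM, rfl⟩ := (mem_weights_iff hMpos).1 hw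
      rcases hcases M hM with ⟨h, -⟩ | ⟨h, -⟩ | h <;> omega
  have hsec : IsLeast (nonMinimumWeights (projectiveCode X)) (q ^ (2 * n - 1)) := by
    constructor
    · refine ⟨?_, _, hmin.1, by omega⟩
      rw [mem_weights_iff hMpos]
      exact ⟨_, vecMulVec_twist_ne_zero σ he0 he1,
        weight_codeword_vecMulVec_of_eq_zero hX hn he0 he1 (by simp [h01])⟩
    · rintro w ⟨hw, v, hv, hvw⟩
      obtain ⟨M, hM, rfl⟩ := (mem_weights_iff hMpos).1 hw
      have := hmin.2 hv
      rcases hcases M hM with ⟨h, -⟩ | ⟨h, -⟩ | h <;> omega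
  -- The weight depends only on the hyperplane, so neither M nor the pair (p, A) has to be recovered
  -- from it.
  have hsing : ∀ M : Matrix (Fin (n + 1)) (Fin (n + 1)) F, IsSingular (arisingHyperplane σ M) →
      weight (codeword X M) = q ^ (2 * n - 1) := by
    rintro M ⟨p, A, hpA, hM⟩
    obtain ⟨a, b, ha, hb, hab, hqs⟩ := exists_eq_quasiSingular hn σ (p := p) (A := A)
    rw [weight_codeword_eq_of_arisingHyperplane_eq hX (hM.trans hqs),
      weight_codeword_vecMulVec_of_eq_zero hX hn ha hb (hab.1 hpA)]
  refine ⟨hmin, hsec, fun M hM => ⟨?_, ?_⟩⟩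
  · rw [isMinimumWeightCodeword_iff hMpos hmin hM]
    constructor
    · intro hw
      refine ⟨?_, fun hs => ?_⟩
      · rcases hcases M hM with ⟨-, h⟩ | ⟨h, -⟩ | h
        · exact h
        · omega
        · omega
      · have := hsing M hs
        omega
    · rintro ⟨⟨p, A, hpA⟩, hns⟩
      obtain ⟨a, b, ha, hb, hab, hqs⟩ := exists_eq_quasiSingular hn σ (p := p) (A := A)
      rw [weight_codeword_eq_of_arisingHyperplane_eq hX (hpA.trans hqs),
        weight_codeword_vecMulVec_of_ne_zero hX hn ha hb
          fun h0 => hns ⟨p, A, hab.2 h0, hpA⟩]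
  · rw [isSecondLowestWeightCodeword_iff hMpos hsec hM]
    constructor
    · intro hw
      rcases hcases M hM with ⟨h, -⟩ | ⟨-, h⟩ | h
      · omega
      · exact h
      · omega
    · exact hsing M

end QuasiSingular

/-! ### Minimality -/

section Minimality

/-- Each relation covers at most q-1 of the (q-1)² admissible pairs, and (q-1)² > 2(q-1) for q ≥ 4.
-/
theorem exists_avoiding_pair {F : Type*} [Finite F] (hF : 4 ≤ Nat.card F) (a₀ b₀ : F)
    {R S : F → F → Prop}
    (hR : ∀ b, b ≠ b₀ → ∀ a a', R a b → R a' b → a = a')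
    (hS : ∀ a, a ≠ a₀ → ∀ b b', S a b → S a b' → b = b') :
    ∃ a b, a ≠ a₀ ∧ b ≠ b₀ ∧ ¬ R a b ∧ ¬ S a b := by
  classical
  have := Fintype.ofFinite F
  by_contra! h
  let A := Finset.univ.erase a₀
  let B := Finset.univ.erase b₀
  have hA : A.card = Nat.card F - 1 := by
    rw [Finset.card_erase_of_mem (Finset.mem_univ _), Finset.card_univ, Nat.card_eq_fintype_card]
  have hB : B.card = Nat.card F - 1 := by
    rw [Finset.card_erase_of_mem (Finset.mem_univ _), Finset.card_univ, Nat.card_eq_fintype_card]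
  have hcover : A ×ˢ B ⊆ (A ×ˢ B).filter (fun p => R p.1 p.2) ∪
      (A ×ˢ B).filter (fun p => S p.1 p.2) := by
    rintro ⟨a, b⟩ hab
    have hab' := Finset.mem_product.1 hab
    rw [Finset.mem_union, Finset.mem_filter, Finset.mem_filter]
    by_cases hr : R a b
    · exact Or.inl ⟨hab, hr⟩
    · exact Or.inr ⟨hab, h a b (Finset.ne_of_mem_erase hab'.1) (Finset.ne_of_mem_erase hab'.2) hr⟩
  have h1 : ((A ×ˢ B).filter (fun p => R p.1 p.2)).card ≤ B.card := by
    refine Finset.card_le_card_of_injOn Prod.snd (fun p hp => ?_) ?_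
    · exact (Finset.mem_product.1 (Finset.mem_filter.1 hp).1).2
    · rintro ⟨a, b⟩ hp ⟨a', b'⟩ hp' (rfl : b = b')
      have hp := Finset.mem_filter.1 hp
      have hp' := Finset.mem_filter.1 hp'
      have := hR b (Finset.ne_of_mem_erase (Finset.mem_product.1 hp.1).2) a a' hp.2 hp'.2
      rw [this]
  have h2 : ((A ×ˢ B).filter (fun p => S p.1 p.2)).card ≤ A.card := by
    refine Finset.card_le_card_of_injOn Prod.fst (fun p hp => ?_) ?_
    · exact (Finset.mem_product.1 (Finset.mem_filter.1 hp).1).1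
    · rintro ⟨a, b⟩ hp ⟨a', b'⟩ hp' (rfl : a = a')
      have hp := Finset.mem_filter.1 hp
      have hp' := Finset.mem_filter.1 hp'
      have := hS a (Finset.ne_of_mem_erase (Finset.mem_product.1 hp.1).1) b b' hp.2 hp'.2
      rw [this]
  have h3 := (Finset.card_le_card hcover).trans (Finset.card_union_le _ _)
  rw [Finset.card_product] at h3
  obtain ⟨k, hk⟩ : ∃ k, Nat.card F - 1 = k + 3 := ⟨Nat.card F - 4, by omega⟩
  rw [hB, hk] at h1
  rw [hA, hk] at h2
  rw [hA, hB, hk] at h3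
  nlinarith

theorem exists_forall_eq_of_subsingleton {F : Type*} [Nonempty F] {P : F → Prop}
    (h : ∀ a b, P a → P b → a = b) :
    ∃ c, ∀ a, P a → a = c := by
  by_cases hP : ∃ c, P c
  · obtain ⟨c, hc⟩ := hP
    exact ⟨c, fun a ha => h a c ha hc⟩
  · exact ⟨Classical.arbitrary F, fun a ha => absurd ⟨a, ha⟩ hP⟩

variable {F : Type*} [Field F]

variable {V : Type*} [AddCommGroup V] [Module F V] {σ : F ≃+* F}

/-- If `g x ∈ ⟨x, f x⟩` for all `x`, then the coefficients of `f` at two vectors `x`, `y` agree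
whenever neither `f x` nor `f y` belongs to `⟨x, y⟩`. -/
theorem coefficient_eq_of_notMem_span {f g : V →ₛₗ[(σ : F →+* F)] V}
    (h : ∀ x, ∃ a b : F, g x = a • x + b • f x) {x y : V}
    (hx : f x ∉ Submodule.span F {x, y}) (hy : f y ∉ Submodule.span F {x, y}) {a b c d : F}
    (hgx : g x = a • x + b • f x) (hgy : g y = c • y + d • f y) : b = d := by
  have hxU : x ∈ Submodule.span F {x, y} := Submodule.subset_span (by simp)
  have hyU : y ∈ Submodule.span F {x, y} := Submodule.subset_span (by simp)
  set U := Submodule.span F {x, y}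
  -- If f(x) and f(y) are dependent modulo U, test the hypothesis on y - σ⁻¹(k) x, whose image under
  -- f lies in U. Otherwise x + y works and coefficients can be compared modulo U.
  by_cases hk : ∃ k : F, f y - k • f x ∈ U
  · obtain ⟨k, hk⟩ := hk
    obtain ⟨a', b', h'⟩ := h (y - σ.symm k • x)
    have hf : f (y - σ.symm k • x) = f y - k • f x := by
      rw [map_sub, map_smulₛₗ]
      simp
    rw [hf, map_sub, map_smulₛₗ, hgx, hgy, RingHom.coe_coe, RingEquiv.apply_symm_apply] at h'
    have h1 : (d - b) • f y ∈ U := by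
      have : (d - b) • f y = a' • (y - σ.symm k • x) + b' • (f y - k • f x) - c • y +
          (k * a) • x - b • (f y - k • f x) := by
        rw [← h']
        module
      rw [this]
      refine U.sub_mem (U.add_mem (U.sub_mem (U.add_mem (U.smul_mem _ (U.sub_mem hyU
        (U.smul_mem _ hxU))) (U.smul_mem _ hk)) (U.smul_mem _ hyU)) (U.smul_mem _ hxU))
        (U.smul_mem _ hk)
    by_contra hbd
    exact hy ((U.smul_mem_iff (sub_ne_zero.2 (Ne.symm hbd))).1 h1)
  · obtain ⟨a', b', h'⟩ := h (x + y)
    rw [map_add, map_add, hgx, hgy] at h'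
    have h1 : (d - b') • f y + (b - b') • f x ∈ U := by
      have : (d - b') • f y + (b - b') • f x = (a' - a) • x + (a' - c) • y := by
        linear_combination (norm := module) (1 : F) • h'
      rw [this]
      exact U.add_mem (U.smul_mem _ hxU) (U.smul_mem _ hyU)
    have hd : d = b' := by
      by_contra hd
      have hd' : d - b' ≠ 0 := sub_ne_zero.2 hd
      refine hk ⟨-((d - b')⁻¹ * (b - b')), ?_⟩
      have := U.smul_mem (d - b')⁻¹ h1
      rwa [smul_add, inv_smul_smul₀ hd', smul_smul, ← sub_neg_eq_add, ← neg_smul] at this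
    rw [hd, sub_self, zero_smul, zero_add] at h1
    rw [hd]
    by_contra hb
    exact hx ((U.smul_mem_iff (sub_ne_zero.2 hb)).1 h1)

/-- The planes ⟨x, w + b y⟩ meet pairwise in ⟨x⟩, and f(x) is outside ⟨x⟩. -/
theorem eq_of_mem_span_pair {f : V →ₛₗ[(σ : F →+* F)] V} {x y w : V}
    (hli : LinearIndependent F ![x, y, w]) (hx : ∀ a : F, f x ≠ a • x) {b b' : F}
    (h : f x ∈ Submodule.span F {x, w + b • y}) (h' : f x ∈ Submodule.span F {x, w + b' • y}) :
    b = b' := by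
  obtain ⟨c, d, h⟩ := Submodule.mem_span_pair.1 h
  obtain ⟨c', d', h'⟩ := Submodule.mem_span_pair.1 h'
  have h0 : (c - c') • x + (d * b - d' * b') • y + (d - d') • w = 0 := by
    have := h.trans h'.symm
    linear_combination (norm := module) (1 : F) • this
  have h1 := Fintype.linearIndependent_iff.1 hli ![c - c', d * b - d' * b', d - d']
    (by simpa [Fin.sum_univ_three] using h0)
  have e1 : d * b - d' * b' = 0 := h1 1
  have e2 : d - d' = 0 := h1 2
  have hd : d ≠ 0 := by
    rintro rfl
    exact hx c (by rw [← h, zero_smul, add_zero])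
  apply mul_left_cancel₀ hd
  linear_combination e1 - b' * e2

/-- The two images differ by σ(a - a') f(x). -/
theorem eq_of_apply_mem_span {f : V →ₛₗ[(σ : F →+* F)] V} {x v : V}
    (hx : f x ∉ Submodule.span F {x, v}) {a a' : F}
    (h : f (v + a • x) ∈ Submodule.span F {x, v}) (h' : f (v + a' • x) ∈ Submodule.span F {x, v}) :
    a = a' := by
  have h1 := Submodule.sub_mem _ h h'
  rw [← map_sub, add_sub_add_left_eq_sub, ← sub_smul, map_smulₛₗ] at h1
  by_contra hne
  have h2 : (σ : F →+* F) (a - a') ≠ 0 := by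
    simpa [sub_eq_zero] using hne
  exact hx ((Submodule.smul_mem_iff _ h2).1 h1)

theorem span_pair_add_smul_left (x v : V) (a : F) :
    Submodule.span F {x, v + a • x} = Submodule.span F {x, v} := by
  apply le_antisymm
  · rw [Submodule.span_le, Set.insert_subset_iff, Set.singleton_subset_iff]
    exact ⟨Submodule.subset_span (by simp), Submodule.mem_span_pair.2 ⟨a, 1, by module⟩⟩
  · rw [Submodule.span_le, Set.insert_subset_iff, Set.singleton_subset_iff]
    exact ⟨Submodule.subset_span (by simp), Submodule.mem_span_pair.2 ⟨-a, 1, by module⟩⟩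

theorem exists_linearIndependent_triple [FiniteDimensional F V] (hV : 3 ≤ Module.finrank F V)
    {x y : V} (hxy : LinearIndependent F ![x, y]) : ∃ w, LinearIndependent F ![x, y, w] := by
  obtain ⟨w, hw⟩ := exists_linearIndependent_snoc_of_lt_finrank hxy hV
  refine ⟨w, ?_⟩
  have : ![x, y, w] = Fin.snoc ![x, y] w := by
    ext i
    fin_cases i <;> rfl
  rwa [this]

/-- If `g x ∈ ⟨x, f x⟩` for all `x`, then `g x ∈ b • f x + ⟨x⟩` for a constant `b`. -/
theorem exists_constant_coefficient [Finite F] [FiniteDimensional F V] (hF : 4 ≤ Nat.card F)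
    (hV : 3 ≤ Module.finrank F V) {f g : V →ₛₗ[(σ : F →+* F)] V}
    (h : ∀ x, ∃ a b : F, g x = a • x + b • f x) :
    ∃ b : F, ∀ x, ∃ a : F, g x = a • x + b • f x := by
  by_cases hgood : ∃ x, ∀ a : F, f x ≠ a • x
  swap
  · push Not at hgood
    refine ⟨0, fun x => ?_⟩
    obtain ⟨a, b, hab⟩ := h x
    obtain ⟨c, hc⟩ := hgood x
    exact ⟨a + b * c, by rw [hab, hc]; module⟩
  obtain ⟨x, hx⟩ := hgood
  obtain ⟨a, b, hab⟩ := h x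
  refine ⟨b, fun y => ?_⟩
  have hx0 : x ≠ 0 := by
    rintro rfl
    exact hx 0 (by simp)
  by_cases hy : ∃ c : F, f y = c • y
  · obtain ⟨c, hc⟩ := hy
    obtain ⟨a', b', hab'⟩ := h y
    exact ⟨a' + b' * c - b * c, by rw [hab', hc]; module⟩
  push Not at hy
  by_cases hxy : LinearIndependent F ![x, y]
  swap
  · rw [LinearIndependent.pair_iff' hx0] at hxy
    push Not at hxy
    obtain ⟨t, rfl⟩ := hxy
    have ht : t ≠ 0 := by
      rintro rfl
      exact hy 0 (by simp)
    refine ⟨σ t * a * t⁻¹, ?_⟩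
    rw [map_smulₛₗ, map_smulₛₗ, hab, smul_smul, mul_assoc (σ t * a), inv_mul_cancel₀ ht]
    simp only [RingHom.coe_coe]
    module
  obtain ⟨w, hw⟩ := exists_linearIndependent_triple hV hxy
  have hw' : LinearIndependent F ![y, x, w] := by
    have := hw.comp _ (Equiv.swap (0 : Fin 3) 1).injective
    convert this using 1
    ext i
    fin_cases i <;> rfl
  obtain ⟨b₀, hb₀⟩ := exists_forall_eq_of_subsingleton
    (P := fun b => f x ∈ Submodule.span F {x, w + b • y})
    fun _ _ h h' => eq_of_mem_span_pair hw hx h h'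
  obtain ⟨a₀, ha₀⟩ := exists_forall_eq_of_subsingleton
    (P := fun a => f y ∈ Submodule.span F {y, w + a • x})
    fun _ _ h h' => eq_of_mem_span_pair hw' hy h h'
  -- Choose z = w + v y + u x so that both pairs (x, z) and (y, z) satisfy
  -- `coefficient_eq_of_notMem_span`; the coefficients at x and y then agree through z.
  obtain ⟨u, v, hu, hv, h1, h2⟩ := exists_avoiding_pair hF a₀ b₀
    (R := fun a b => f (w + b • y + a • x) ∈ Submodule.span F {x, w + b • y})
    (S := fun a b => f (w + a • x + b • y) ∈ Submodule.span F {y, w + a • x})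
    (fun b hb a a' h h' => eq_of_apply_mem_span (fun h0 => hb (hb₀ b h0)) h h')
    (fun a ha b b' h h' => eq_of_apply_mem_span (fun h0 => ha (ha₀ a h0)) h h')
  obtain ⟨c, d, hcd⟩ := h (w + v • y + u • x)
  obtain ⟨a', b', hab'⟩ := h y
  have hz : w + v • y + u • x = w + u • x + v • y := by abel
  have e1 : b = d := by
    refine coefficient_eq_of_notMem_span h (x := x) (y := w + v • y + u • x) ?_ ?_ hab hcd
    · rw [span_pair_add_smul_left]
      exact fun h0 => hv (hb₀ v h0)
    · rwa [span_pair_add_smul_left]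
  have e2 : b' = d := by
    refine coefficient_eq_of_notMem_span h (x := y) (y := w + v • y + u • x) ?_ ?_ hab' hcd
    · rw [hz, span_pair_add_smul_left]
      exact fun h0 => hu (ha₀ u h0)
    · rwa [hz, span_pair_add_smul_left]
  exact ⟨a', by rw [e1, ← e2, hab']⟩

theorem isMinimalCode_projectiveCode [Finite F] {n : ℕ} {σ : F ≃+* F} (hσ : σ ≠ 1)
    {X : projectiveSystem n σ → Matrix (Fin (n + 1)) (Fin (n + 1)) F} (hX : IsRepresentatives X)
    (hn : 2 ≤ n) : IsMinimalCode (projectiveCode X) := by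
  intro c hc c' hc' hsupp
  obtain ⟨M, rfl⟩ := mem_projectiveCode.1 hc
  obtain ⟨M', rfl⟩ := mem_projectiveCode.1 hc'
  have hle : ∀ P : PHPoint F n, P ∈ arisingHyperplane σ M → P ∈ arisingHyperplane σ M' := by
    intro P hP
    rw [← codeword_apply_eq_zero_iff hX] at hP ⊢
    by_contra h
    exact hsupp h hP
  -- Every hyperplane containing x and f(x) also contains the image of x under M', by inclusion of
  -- the zero sets.
  have hspan : ∀ x, ∃ a b : F, twistedMap σ M' x = a • x + b • twistedMap σ M x := by
    intro x
    by_cases hx : x = 0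
    · exact ⟨0, 0, by simp [hx]⟩
    have : twistedMap σ M' x ∈ Submodule.span F {x, twistedMap σ M x} := by
      by_contra hmem
      obtain ⟨ξ, hξ, hne⟩ := exists_dotProduct_ne_zero hmem
      rw [mem_annihilator_span] at hξ
      have hξ0 : ξ ≠ 0 := fun h => hne (by rw [h, zero_dotProduct])
      have hinc : Incident (Projectivization.mk F x hx) (Projectivization.mk F ξ hξ0) :=
        hξ x (by simp)
      have := hle ⟨_, _, hinc⟩ ((mk_mem_arisingHyperplane hx hξ0 hinc).2 (hξ _ (by simp)))
      exact hne ((mk_mem_arisingHyperplane hx hξ0 hinc).1 this)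
    obtain ⟨a, b, h⟩ := Submodule.mem_span_pair.1 this
    exact ⟨a, b, h.symm⟩
  obtain ⟨b, hb⟩ := exists_constant_coefficient (four_le_card hσ)
    (by rw [Module.finrank_fin_fun]; omega) hspan
  refine ⟨b, ?_⟩
  have hsub : codeword X (M' - b • M) = 0 := by
    ext ⟨_, P, rfl⟩
    refine (codeword_apply_eq_zero_iff hX _ P).2 ?_
    obtain ⟨a, ha⟩ := hb P.pt.rep
    have : twistedMap σ (M' - b • M) P.pt.rep = a • P.pt.rep := by
      rw [twistedMap_apply, Matrix.sub_mulVec, Matrix.smul_mulVec, ← twistedMap_apply,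
        ← twistedMap_apply, ha, add_sub_cancel_right]
    rw [mem_arisingHyperplane, this, dotProduct_smul, incident_iff_rep.1 P.incident, smul_zero]
  ext p
  have := congrFun hsub p
  simp only [codeword, mul_sub, Matrix.trace_sub, Matrix.mul_smul, Matrix.trace_smul,
    Pi.zero_apply, sub_eq_zero] at this
  exact this

end Minimality

/-! ### The plane with an involutory automorphism -/

section Plane

variable {F : Type*} [Field F] {σ : F ≃+* F}

theorem apply_apply_of_sq_eq_one (hσ2 : σ ^ 2 = 1) (x : F) : σ (σ x) = x := by
  have := congrArg (fun e : F ≃+* F => e x) hσ2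
  simpa [pow_two] using this

theorem pow_card_fixed_add_one [Finite F] (hσ : σ ≠ 1) (hσ2 : σ ^ 2 = 1) (x : F) :
    x ^ (Nat.card {a : F // σ a = a} + 1) = x * σ x := by
  rw [apply_eq_pow_card_fixed hσ hσ2, pow_succ']

/-! ### Eigenvectors with equal eigenvalues or equal norms, and fixed subplanes -/

section FixedVectors

variable {V : Type*} [AddCommGroup V] [Module F V]

/-- A semilinear map with three independent eigenvectors with the same eigenvalue fixes all points
of a subplane. -/
theorem le_ncard_eigenpoints_of_eigenvalue_eq [Finite F] [Finite V] (f : V →ₛₗ[(σ : F →+* F)] V)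
    {y : Fin 3 → V} (hy : LinearIndependent F y) {c : F} (hf : ∀ i, f (y i) = c • y i) :
    Nat.card {a : F // σ a = a} ^ 2 + Nat.card {a : F // σ a = a} + 1 ≤
      (eigenpoints f).ncard := by
  classical
  have := Fintype.ofFinite F
  have hs := two_le_card_fixed σ
  set s := Nat.card {a : F // σ a = a} with hsdef
  let K : Finset F := Finset.univ.filter fun a => σ a = a
  have hK : K.card = s := by
    rw [hsdef, Nat.card_eq_fintype_card, Fintype.card_subtype]
  -- The s³-1 non-zero combinations with coefficients in the fixed field are eigenvectors, and at
  -- most s-1 of them span a given point.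
  let T : Finset (Fin 3 → F) := (Fintype.piFinset fun _ => K).erase 0
  have hT : T.card = s ^ 3 - 1 := by
    rw [Finset.card_erase_of_mem, Fintype.card_piFinset_const, hK]
    simp [K]
  have hsum0 : ∀ a : Fin 3 → F, ∑ i, a i • y i = 0 → a = 0 := fun a h =>
    funext fun i => Fintype.linearIndependent_iff.1 hy a h i
  let E : Set (Submodule F V) := Projectivization.submodule '' eigenpoints f
  have hEfin : E.Finite := Set.toFinite _
  have hmap : ∀ a ∈ T, Submodule.span F {∑ i, a i • y i} ∈ hEfin.toFinset := by
    intro a ha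
    have ha0 : ∑ i, a i • y i ≠ 0 := fun h => (Finset.mem_erase.1 ha).1 (hsum0 a h)
    rw [Set.Finite.mem_toFinset]
    refine ⟨Projectivization.mk F _ ha0, (mk_mem_eigenpoints ha0).2 ⟨c, ?_⟩, rfl⟩
    rw [map_sum, Finset.smul_sum]
    refine Finset.sum_congr rfl fun i _ => ?_
    have : σ (a i) = a i :=
      (Finset.mem_filter.1 (Fintype.mem_piFinset.1 (Finset.mem_erase.1 ha).2 i)).2
    rw [map_smulₛₗ, hf, RingHom.coe_coe, this, smul_comm]
  have hfiber : ∀ U ∈ hEfin.toFinset,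
      (T.filter fun a => Submodule.span F {∑ i, a i • y i} = U).card ≤ s - 1 := by
    intro U _
    rcases Finset.eq_empty_or_nonempty
      (T.filter fun a => Submodule.span F {∑ i, a i • y i} = U) with h | ⟨b, hb⟩
    · rw [h]
      simp
    rw [Finset.mem_filter] at hb
    obtain ⟨j, hj⟩ := Function.ne_iff.1 (Finset.mem_erase.1 hb.1).1
    have hj : b j ≠ 0 := hj
    have hprop : ∀ a ∈ T.filter fun a => Submodule.span F {∑ i, a i • y i} = U,
        ∃ t : F, t ≠ 0 ∧ a = t • b := by
      intro a ha
      rw [Finset.mem_filter] at ha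
      obtain ⟨t, ht⟩ := Submodule.span_singleton_eq_span_singleton.1 (hb.2.trans ha.2.symm)
      refine ⟨t, t.ne_zero, ?_⟩
      rw [← sub_eq_zero]
      apply hsum0
      simp only [Pi.sub_apply, Pi.smul_apply, sub_smul, Finset.sum_sub_distrib, ← ht,
        Units.smul_def, Finset.smul_sum, smul_assoc, sub_self]
    have hcard : (K.erase 0).card = s - 1 := by
      rw [Finset.card_erase_of_mem (by simp [K]), hK]
    rw [← hcard]
    refine Finset.card_le_card_of_injOn (fun a => a j) (fun a ha => ?_) fun a ha a' ha' h => ?_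
    · obtain ⟨t, ht, rfl⟩ := hprop a ha
      refine Finset.mem_erase.2 ⟨mul_ne_zero ht hj, ?_⟩
      exact Fintype.mem_piFinset.1 (Finset.mem_erase.1 (Finset.mem_filter.1 ha).1).2 j
    · obtain ⟨t, -, rfl⟩ := hprop a ha
      obtain ⟨t', -, rfl⟩ := hprop a' ha'
      have : t = t' := mul_right_cancel₀ hj h
      rw [this]
  have hle := Finset.card_le_mul_card_image_of_maps_to hmap (s - 1) hfiber
  rw [hT, ← Set.ncard_eq_toFinset_card _ hEfin,
    Set.ncard_image_of_injective _ Projectivization.submodule_injective] at hle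
  obtain ⟨k, hk⟩ : ∃ k, s = k + 1 := ⟨s - 1, by omega⟩
  have h3 : s ^ 3 - 1 = (s - 1) * (s ^ 2 + s + 1) := by
    rw [hk, Nat.add_sub_cancel]
    apply Nat.sub_eq_of_eq_add
    ring
  rw [h3] at hle
  exact Nat.le_of_mul_le_mul_left hle (by omega)

theorem le_ncard_eigenpoints_of_norm_eq [Finite F] [Finite V] (hσ : σ ≠ 1) (hσ2 : σ ^ 2 = 1)
    (f : V →ₛₗ[(σ : F →+* F)] V) {x : Fin 3 → V} (hx : LinearIndependent F x) {l : Fin 3 → F}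
    (hl : ∀ i, l i ≠ 0) (hf : ∀ i, f (x i) = l i • x i)
    (hN : ∀ i j, l i ^ (Nat.card {a : F // σ a = a} + 1) =
      l j ^ (Nat.card {a : F // σ a = a} + 1)) :
    Nat.card {a : F // σ a = a} ^ 2 + Nat.card {a : F // σ a = a} + 1 ≤
      (eigenpoints f).ncard := by
  -- The quotient has norm 1, so Hilbert 90 gives a rescaling of `x i` with eigenvalue `l 0`.
  have h : ∀ i, ∃ a : F, a ≠ 0 ∧ l i / l 0 * σ a = a := fun i => by
    apply exists_ne_zero_mul_apply_eq hσ hσ2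
    have h1 := hN i 0
    rw [pow_card_fixed_add_one hσ hσ2, pow_card_fixed_add_one hσ hσ2] at h1
    have h2 : σ (l 0) ≠ 0 := by simpa using hl 0
    have h3 := hl 0
    rw [map_div₀]
    field_simp
    exact h1
  choose a ha0 ha using h
  refine le_ncard_eigenpoints_of_eigenvalue_eq f (y := fun i => a i • x i)
    (hx.units_smul fun i => Units.mk0 (a i) (ha0 i)) (c := l 0) fun i => ?_
  rw [map_smulₛₗ, hf, smul_smul, smul_smul]
  congr 1
  have h1 := ha i
  have h2 := hl 0
  field_simp at h1
  rw [RingHom.coe_coe]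
  linear_combination h1

end FixedVectors

/-- Kernels of dimension 1 and 2 give at most s+2 and s²+2 eigenpoints, both below s²+s+1. With
trivial kernel, equality needs three eigenvectors and enough non-zero solutions in the coordinate
sets. -/
theorem ncard_eigenpoints_plane_le [Finite F] (hσ : σ ≠ 1) (hσ2 : σ ^ 2 = 1)
    {M : Matrix (Fin (2 + 1)) (Fin (2 + 1)) F} (hM : M ≠ 0) :
    (eigenpoints (twistedMap σ M)).ncard ≤
        Nat.card {a : F // σ a = a} ^ 2 + Nat.card {a : F // σ a = a} + 1 ∧
      (Nat.card {a : F // σ a = a} ^ 2 + Nat.card {a : F // σ a = a} + 1 ≤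
          (eigenpoints (twistedMap σ M)).ncard →
        ∃ (x : Fin 3 → Fin (2 + 1) → F) (l : Fin 3 → F), LinearIndependent F x ∧
          (∀ i, l i ≠ 0) ∧ (∀ i, twistedMap σ M (x i) = l i • x i) ∧
          ∀ i j, l i ^ (Nat.card {a : F // σ a = a} + 1) =
            l j ^ (Nat.card {a : F // σ a = a} + 1)) := by
  have hs := two_le_card_fixed σ
  have hq := card_eq_card_fixed_sq hσ hσ2
  have hss : 2 * Nat.card {a : F // σ a = a} ≤ Nat.card {a : F // σ a = a} ^ 2 := by nlinarith
  obtain ⟨r, x, l, hx, hl, hf, hspan, hr⟩ := exists_independent_eigenvectors (twistedMap σ M)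
  have h1 := ncard_eigenpoints_le (twistedMap σ M)
  have h2 := ncard_eigenpoints_not_le_ker_le (twistedMap σ M) hx hf hspan
  have h3 := sum_prod_ncard_coordinateSet_le σ hl
  rw [Module.finrank_fin_fun] at hr
  have hdcases : Module.finrank F (LinearMap.ker (twistedMap σ M)) = 0 ∨
      Module.finrank F (LinearMap.ker (twistedMap σ M)) = 1 ∨
      2 ≤ Module.finrank F (LinearMap.ker (twistedMap σ M)) := by omega
  rcases hdcases with hd | hd | hd
  · rw [hd, Finset.sum_range_zero, zero_add] at h1
    rcases (show r ≤ 2 ∨ r = 3 by omega) with hr2 | rfl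
    · have h4 : ∑ i ∈ Finset.range r, Nat.card {a : F // σ a = a} ^ i ≤
          ∑ i ∈ Finset.range 2, Nat.card {a : F // σ a = a} ^ i :=
        Finset.sum_le_sum_of_subset (Finset.range_subset_range.2 hr2)
      simp only [Finset.sum_range_succ, Finset.sum_range_zero, zero_add, pow_zero, pow_one] at h4
      constructor
      · omega
      · intro h
        omega
    · have h4 := h3
      simp only [Finset.sum_range_succ, Finset.sum_range_zero, zero_add, pow_zero, pow_one] at h4
      refine ⟨by omega, fun h => ⟨x, l, hx, hl, hf, ?_⟩⟩
      have hle : ∀ i j : Fin 3, i < j →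
          (coordinateSet σ l i j).ncard ≤ Nat.card {a : F // σ a = a} := fun i j hij => by
        rw [coordinateSet_of_lt σ l hij]
        exact ncard_semilinear_eigen_le σ (hl i) (hl j)
      have hsum : ∑ i, ∏ j, (coordinateSet σ l i j).ncard =
          (coordinateSet σ l 0 1).ncard * (coordinateSet σ l 0 2).ncard +
            (coordinateSet σ l 1 2).ncard + 1 := by
        simp only [Fin.sum_univ_three, Fin.prod_univ_three]
        rw [ncard_coordinateSet_of_le σ l (le_refl (0 : Fin 3)),
          ncard_coordinateSet_of_le σ l (show (0 : Fin 3) ≤ 1 by decide),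
          ncard_coordinateSet_of_le σ l (show (1 : Fin 3) ≤ 1 by decide),
          ncard_coordinateSet_of_le σ l (show (0 : Fin 3) ≤ 2 by decide),
          ncard_coordinateSet_of_le σ l (show (1 : Fin 3) ≤ 2 by decide),
          ncard_coordinateSet_of_le σ l (show (2 : Fin 3) ≤ 2 by decide)]
        ring
      have e1 := hle 0 1 (by decide)
      have e2 := hle 0 2 (by decide)
      rw [hsum] at h2
      have e3 := hle 1 2 (by decide)
      set s := Nat.card {a : F // σ a = a}
      -- A non-zero solution of σ(a) l_j = l_i a, multiplied with its conjugate equation, equates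
      -- the norms.
      have hnorm : ∀ i j : Fin 3, i < j → 2 ≤ (coordinateSet σ l i j).ncard →
          l i ^ (s + 1) = l j ^ (s + 1) := by
        intro i j hij hc
        rw [coordinateSet_of_lt σ l hij] at hc
        obtain ⟨a, ha, ha0⟩ := Set.exists_ne_of_one_lt_ncard hc 0
        have ha : σ a * l j = l i * a := ha
        rw [pow_card_fixed_add_one hσ hσ2, pow_card_fixed_add_one hσ hσ2]
        have hb := congrArg σ ha
        rw [map_mul, map_mul, apply_apply_of_sq_eq_one hσ2] at hb
        have hσa : σ a ≠ 0 := by simpa using ha0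
        apply mul_left_cancel₀ (mul_ne_zero ha0 hσa)
        linear_combination (-(l i) * a) * hb - a * σ (l j) * ha
      -- Were either factor at most 1, the total would be at most s + s + 1 < s² + s + 1.
      have c01 : 2 ≤ (coordinateSet σ l 0 1).ncard := by nlinarith
      have c02 : 2 ≤ (coordinateSet σ l 0 2).ncard := by nlinarith
      have n01 := hnorm 0 1 (by decide) c01
      have n02 := hnorm 0 2 (by decide) c02
      intro i j
      fin_cases i <;> fin_cases j <;> simp_all
  · have h4 : ∑ i ∈ Finset.range r, Nat.card {a : F // σ a = a} ^ i ≤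
        ∑ i ∈ Finset.range 2, Nat.card {a : F // σ a = a} ^ i :=
      Finset.sum_le_sum_of_subset (Finset.range_subset_range.2 (by omega))
    rw [hd] at h1
    simp only [Finset.sum_range_succ, Finset.sum_range_zero, zero_add, pow_zero, pow_one] at h4 h1
    constructor
    · omega
    · intro h
      omega
  · have hlt : (eigenpoints (twistedMap σ M)).ncard <
        Nat.card {a : F // σ a = a} ^ 2 + Nat.card {a : F // σ a = a} + 1 := by
      obtain ⟨a, b, ha, hb, rfl⟩ := exists_eq_vecMulVec_of_le_finrank_ker σ hM hd
      have h5 := ncard_eigenpoints_add_ncard_compl σ (Matrix.vecMulVec a fun i => σ (b i))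
      simp only [Finset.sum_range_succ, Finset.sum_range_zero, zero_add, pow_zero, pow_one] at h5
      by_cases hab : b ⬝ᵥ a = 0
      · have := ncard_compl_eigenpoints_vecMulVec_of_eq_zero σ ha hb hab
        omega
      · have := ncard_compl_eigenpoints_vecMulVec_of_ne_zero σ ha hb hab
        omega
    exact ⟨hlt.le, fun h => absurd h hlt.not_ge⟩

/-- Left eigenvectors and right eigenvectors of a semilinear map. -/
theorem mul_map_eq_iff {ι : Type*} [Fintype ι] [DecidableEq ι] {A B M : Matrix ι ι F}
    (hAB : A * B = 1) (α : ι → F) :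
    A * M = Matrix.diagonal α * A.map σ ↔ M * B.map σ = B * Matrix.diagonal α := by
  have hBA : B * A = 1 := mul_eq_one_comm.1 hAB
  have hAB' : A.map σ * B.map σ = 1 := by
    rw [← Matrix.map_mul, hAB, Matrix.map_one _ (map_zero σ) (map_one σ)]
  have hBA' : B.map σ * A.map σ = 1 := mul_eq_one_comm.1 hAB'
  constructor
  · intro h
    calc M * B.map σ = B * (A * M) * B.map σ := by rw [← mul_assoc B, hBA, one_mul]
      _ = B * Matrix.diagonal α * (A.map σ * B.map σ) := by rw [h]; simp only [mul_assoc]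
      _ = B * Matrix.diagonal α := by rw [hAB', mul_one]
  · intro h
    calc A * M = A * (M * B.map σ) * A.map σ := by rw [mul_assoc, mul_assoc, hBA', mul_one]
      _ = (A * B) * Matrix.diagonal α * A.map σ := by rw [h]; simp only [mul_assoc]
      _ = Matrix.diagonal α * A.map σ := by rw [hAB, one_mul]

/-- If the rows of A are left eigenvectors, the columns of A⁻¹ are eigenvectors of x ↦ M x^σ with
the same α, and conversely. -/
theorem exists_left_eigenvectors_iff {n : ℕ} {M : Matrix (Fin (n + 1)) (Fin (n + 1)) F}
    (α : Fin (n + 1) → F) :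
    (∃ ξ : Fin (n + 1) → Fin (n + 1) → F, LinearIndependent F ξ ∧
      ∀ i, ξ i ᵥ* M = α i • fun k => σ (ξ i k)) ↔
    ∃ x : Fin (n + 1) → Fin (n + 1) → F, LinearIndependent F x ∧
      ∀ i, twistedMap σ M (x i) = α i • x i := by
  have hrow : ∀ A : Matrix (Fin (n + 1)) (Fin (n + 1)) F,
      A * M = Matrix.diagonal α * A.map σ ↔ ∀ i, A i ᵥ* M = α i • fun k => σ (A i k) := by
    intro A
    rw [← Matrix.ext_iff]
    simp only [funext_iff, Matrix.diagonal_mul, Matrix.map_apply, Pi.smul_apply, smul_eq_mul]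
    rfl
  have hcol : ∀ B : Matrix (Fin (n + 1)) (Fin (n + 1)) F,
      M * B.map σ = B * Matrix.diagonal α ↔ ∀ i, twistedMap σ M (Bᵀ i) = α i • Bᵀ i := by
    intro B
    rw [← Matrix.ext_iff, forall_comm]
    simp only [funext_iff, Matrix.mul_diagonal, Pi.smul_apply, smul_eq_mul, mul_comm (α _)]
    rfl
  constructor
  · rintro ⟨ξ, hξ, h⟩
    have hu : IsUnit (Matrix.of ξ) := Matrix.linearIndependent_rows_iff_isUnit.1 hξ
    obtain ⟨B, hB⟩ := hu.exists_right_inv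
    refine ⟨Bᵀ, ?_, (hcol B).1 ((mul_map_eq_iff hB α).1 ((hrow _).2 h))⟩
    exact Matrix.linearIndependent_cols_iff_isUnit.2
      (IsUnit.of_mul_eq_one _ (mul_eq_one_comm.1 hB))
  · rintro ⟨x, hx, h⟩
    have hu : IsUnit (Matrix.of x)ᵀ := by
      rw [← Matrix.linearIndependent_cols_iff_isUnit]
      exact hx
    obtain ⟨A, hA⟩ := hu.exists_left_inv
    refine ⟨A, ?_, (hrow A).1 ((mul_map_eq_iff hA α).2 ((hcol _).2 h))⟩
    exact Matrix.linearIndependent_rows_iff_isUnit.2 (IsUnit.of_mul_eq_one _ hA)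

theorem plane_minimum_weight [Finite F] (hσ : σ ≠ 1) (hσ2 : σ ^ 2 = 1)
    {X : projectiveSystem 2 σ → Matrix (Fin (2 + 1)) (Fin (2 + 1)) F} (hX : IsRepresentatives X) :
    IsLeast (weights (projectiveCode X))
        (Nat.card F ^ 3 - Nat.card {a : F // σ a = a} ^ 3) ∧
      ∀ M : Matrix (Fin (2 + 1)) (Fin (2 + 1)) F, M ≠ 0 →
        (IsMinimumWeightCodeword (projectiveCode X) (codeword X M) ↔
          ∃ (ξ : Fin 3 → Fin (2 + 1) → F) (α : Fin 3 → F),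
            LinearIndependent F ξ ∧ (∀ i, α i ≠ 0) ∧
            (∀ i, ξ i ᵥ* M = α i • fun k => σ (ξ i k)) ∧
            ∀ i j, α i ^ (Nat.card {a : F // σ a = a} + 1) =
              α j ^ (Nat.card {a : F // σ a = a} + 1)) := by
  have hs := two_le_card_fixed σ
  have hq := card_eq_card_fixed_sq hσ hσ2
  have hrows : ∀ M : Matrix (Fin (2 + 1)) (Fin (2 + 1)) F,
      (∃ (ξ : Fin 3 → Fin (2 + 1) → F) (α : Fin 3 → F),
        LinearIndependent F ξ ∧ (∀ i, α i ≠ 0) ∧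
        (∀ i, ξ i ᵥ* M = α i • fun k => σ (ξ i k)) ∧
        ∀ i j, α i ^ (Nat.card {a : F // σ a = a} + 1) =
          α j ^ (Nat.card {a : F // σ a = a} + 1)) ↔
      ∃ (x : Fin 3 → Fin (2 + 1) → F) (l : Fin 3 → F), LinearIndependent F x ∧
        (∀ i, l i ≠ 0) ∧ (∀ i, twistedMap σ M (x i) = l i • x i) ∧
        ∀ i j, l i ^ (Nat.card {a : F // σ a = a} + 1) =
          l j ^ (Nat.card {a : F // σ a = a} + 1) := by
    intro M
    constructor
    · rintro ⟨ξ, α, hξ, hα, h, hN⟩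
      obtain ⟨x, hx, hx'⟩ := (exists_left_eigenvectors_iff α).1 ⟨ξ, hξ, h⟩
      exact ⟨x, α, hx, hα, hx', hN⟩
    · rintro ⟨x, α, hx, hα, h, hN⟩
      obtain ⟨ξ, hξ, hξ'⟩ := (exists_left_eigenvectors_iff α).2 ⟨x, hx, h⟩
      exact ⟨ξ, α, hξ, hα, hξ', hN⟩
  set s := Nat.card {a : F // σ a = a} with hsdef
  have hweight : ∀ M : Matrix (Fin (2 + 1)) (Fin (2 + 1)) F,
      weight (codeword X M) + s ^ 2 * (eigenpoints (twistedMap σ M)).ncard =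
        (s ^ 6 - s ^ 3) + s ^ 2 * (s ^ 2 + s + 1) := by
    intro M
    have h1 := weight_codeword_eq_mul (by omega) hX M
    have h2 := ncard_eigenpoints_add_ncard_compl σ M
    simp only [Finset.sum_range_succ, Finset.sum_range_zero, zero_add, pow_zero, pow_one, hq] at h2
    have h3 : s ^ 3 ≤ s ^ 6 := Nat.pow_le_pow_right (by omega) (by omega)
    rw [h1, hq]
    zify [h3] at h2 ⊢
    linear_combination (s : ℤ) ^ 2 * h2
  have hlt : s ^ 3 < s ^ 6 := Nat.pow_lt_pow_right (by omega) (by omega)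
  have hle : ∀ M : Matrix (Fin (2 + 1)) (Fin (2 + 1)) F, M ≠ 0 →
      s ^ 6 - s ^ 3 ≤ weight (codeword X M) := by
    intro M hM
    have h1 := hweight M
    have h2 := Nat.mul_le_mul_left (s ^ 2) (ncard_eigenpoints_plane_le hσ hσ2 hM).1
    rw [← hsdef] at h2
    omega
  have heq : ∀ M : Matrix (Fin (2 + 1)) (Fin (2 + 1)) F, M ≠ 0 →
      (weight (codeword X M) = s ^ 6 - s ^ 3 ↔
        s ^ 2 + s + 1 ≤ (eigenpoints (twistedMap σ M)).ncard) := by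
    intro M hM
    have h1 := hweight M
    have h3 := hle M hM
    constructor
    · intro h
      have : s ^ 2 * (eigenpoints (twistedMap σ M)).ncard = s ^ 2 * (s ^ 2 + s + 1) := by omega
      exact (Nat.eq_of_mul_eq_mul_left (by positivity) this).ge
    · intro h
      have := Nat.mul_le_mul_left (s ^ 2) h
      omega
  have hpos : ∀ M, M ≠ 0 → 0 < weight (codeword X M) := fun M hM => by
    have := hle M hM
    omega
  have hiff : ∀ M : Matrix (Fin (2 + 1)) (Fin (2 + 1)) F, M ≠ 0 →
      (weight (codeword X M) = s ^ 6 - s ^ 3 ↔ ∃ (x : Fin 3 → Fin (2 + 1) → F) (l : Fin 3 → F),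
        LinearIndependent F x ∧ (∀ i, l i ≠ 0) ∧ (∀ i, twistedMap σ M (x i) = l i • x i) ∧
        ∀ i j, l i ^ (s + 1) = l j ^ (s + 1)) := by
    intro M hM
    rw [heq M hM]
    constructor
    · exact (ncard_eigenpoints_plane_le hσ hσ2 hM).2
    · rintro ⟨x, l, hx, hl, hf, hN⟩
      exact le_ncard_eigenpoints_of_norm_eq hσ hσ2 _ hx hl hf hN
  have hmin : IsLeast (weights (projectiveCode X)) (s ^ 6 - s ^ 3) := by
    constructor
    · rw [mem_weights_iff hpos]
      -- The identity matrix attains the bound: x ↦ x^σ fixes the standard basis.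
      refine ⟨1, one_ne_zero, (hiff 1 one_ne_zero).2 ((hrows 1).1
        ⟨(1 : Matrix (Fin 3) (Fin 3) F), fun _ => 1, ?_, fun _ => one_ne_zero, fun i => ?_,
          fun _ _ => rfl⟩)⟩
      · exact Matrix.linearIndependent_rows_iff_isUnit.2 isUnit_one
      · rw [Matrix.vecMul_one, one_smul]
        ext k
        by_cases h : i = k
        · rw [h, Matrix.one_apply_eq, map_one]
        · rw [Matrix.one_apply_ne h, map_zero]
    · intro w hw
      obtain ⟨M, hM, rfl⟩ := (mem_weights_iff hpos).1 hw
      exact hle M hM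
  have hq3 : Nat.card F ^ 3 = s ^ 6 := by rw [hq]; ring
  rw [hq3]
  refine ⟨hmin, fun M hM => ?_⟩
  rw [isMinimumWeightCodeword_iff hpos hmin hM, hiff M hM, hrows M]

end Plane

/-! ### The maximum weight -/

section MaximumWeight

variable {F : Type*} [Field F] {n : ℕ} {σ : F ≃+* F}

theorem card_pow_mul_sum_eq [Finite F] :
    Nat.card F ^ (n - 1) * ∑ i ∈ Finset.range (n + 1), Nat.card F ^ i =
      Nat.card F ^ (n - 1) * (Nat.card F ^ (n + 1) - 1) / (Nat.card F - 1) := by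
  have hF : 2 ≤ Nat.card F := Finite.one_lt_card
  rw [Nat.geomSum_eq hF, Nat.mul_div_assoc]
  simpa using Nat.sub_dvd_pow_sub_pow (Nat.card F) 1 (n + 1)

theorem isMaximumWeightCodeword_of_eigenpoints_eq_empty [Finite F] (hn : 1 ≤ n)
    {X : projectiveSystem n σ → Matrix (Fin (n + 1)) (Fin (n + 1)) F} (hX : IsRepresentatives X)
    {M : Matrix (Fin (n + 1)) (Fin (n + 1)) F} (hM : eigenpoints (twistedMap σ M) = ∅) :
    IsMaximumWeightCodeword (projectiveCode X) (codeword X M) ∧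
      weight (codeword X M) =
        Nat.card F ^ (n - 1) * (Nat.card F ^ (n + 1) - 1) / (Nat.card F - 1) := by
  have hw : weight (codeword X M) =
      Nat.card F ^ (n - 1) * ∑ i ∈ Finset.range (n + 1), Nat.card F ^ i := by
    rw [weight_codeword_eq_mul hn hX, ← ncard_eigenpoints_add_ncard_compl σ M, hM,
      Set.ncard_empty, zero_add]
  have hpos : 0 < weight (codeword X M) := by
    rw [hw, Finset.sum_range_succ]
    have : 0 < Nat.card F := Nat.card_pos
    positivity
  refine ⟨⟨mem_projectiveCode.2 ⟨M, rfl⟩, ne_zero_of_weight_pos hpos,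
    ⟨_, mem_projectiveCode.2 ⟨M, rfl⟩, ne_zero_of_weight_pos hpos, rfl⟩, ?_⟩,
    hw.trans card_pow_mul_sum_eq⟩
  rintro w ⟨c, hc, -, rfl⟩
  obtain ⟨M', rfl⟩ := mem_projectiveCode.1 hc
  rw [hw, weight_codeword_eq_mul hn hX, ← ncard_eigenpoints_add_ncard_compl σ M']
  exact Nat.mul_le_mul_left _ (Nat.le_add_left _ _)

/-- σ preserves squares and nonsquares, and a product of two nonsquares in a finite field is a
square. -/
theorem isSquare_mul_apply [Finite F] (σ : F ≃+* F) (u : F) : IsSquare (u * σ u) := by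
  by_cases hu : IsSquare u
  · exact hu.mul (hu.map σ)
  · classical
    have := Fintype.ofFinite F
    have hσu : ¬ IsSquare (σ u) := fun h => hu (by simpa using h.map σ.symm)
    have hu0 : u ≠ 0 := by
      rintro rfl
      exact hu IsSquare.zero
    have hσu0 : σ u ≠ 0 := by simpa using hu0
    rw [← quadraticChar_one_iff_isSquare (mul_ne_zero hu0 hσu0), map_mul,
      quadraticChar_neg_one_iff_not_isSquare.2 hu, quadraticChar_neg_one_iff_not_isSquare.2 hσu]
    norm_num

/-- The matrix with antidiagonal entries `a` (in the upper half) and `1` (in the lower half). -/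
def antidiagonalMatrix (n : ℕ) (a : F) : Matrix (Fin (n + 1)) (Fin (n + 1)) F :=
  Matrix.of fun i j => if j = i.rev then (if i < i.rev then a else 1) else 0

theorem twistedMap_antidiagonalMatrix (σ : F ≃+* F) (a : F) (x : Fin (n + 1) → F)
    (i : Fin (n + 1)) :
    twistedMap σ (antidiagonalMatrix n a) x i = (if i < i.rev then a else 1) * σ (x i.rev) := by
  rw [twistedMap_apply, Matrix.mulVec, dotProduct, Finset.sum_eq_single i.rev]
  · simp [antidiagonalMatrix]
  · intro j _ hj
    simp [antidiagonalMatrix, hj]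
  · simp

theorem eigenpoints_antidiagonalMatrix_eq_empty [Finite F] (σ : F ≃+* F) (hn : Odd n) {a : F}
    (ha : ¬ IsSquare a) : eigenpoints (twistedMap σ (antidiagonalMatrix n a)) = ∅ := by
  rw [Set.eq_empty_iff_forall_notMem]
  intro p hp
  induction p using Projectivization.ind with | h x hx =>
  obtain ⟨c, hc⟩ := (mk_mem_eigenpoints hx).1 hp
  -- Since n + 1 is even, no index is its own mirror image.
  have hrev : ∀ i : Fin (n + 1), i < i.rev ∨ i.rev < i := fun i => by
    obtain ⟨k, hk⟩ := hn
    simp only [Fin.lt_def, Fin.val_rev]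
    omega
  have key : ∀ i : Fin (n + 1), i < i.rev → x i = 0 ∧ x i.rev = 0 := by
    intro i hi
    have h1 := congrFun hc i
    have h2 := congrFun hc i.rev
    rw [twistedMap_antidiagonalMatrix, if_pos hi, Pi.smul_apply, smul_eq_mul] at h1
    rw [twistedMap_antidiagonalMatrix, Fin.rev_rev, if_neg hi.not_gt, one_mul, Pi.smul_apply,
      smul_eq_mul] at h2
    by_cases hv : x i.rev = 0
    · rw [hv, mul_zero, EmbeddingLike.map_eq_zero_iff] at h2
      exact ⟨h2, hv⟩
    · exfalso
      have hσv : σ (x i.rev) ≠ 0 := by simpa using hv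
      -- Eliminating the eigenvalue c from the two mirrored equations exhibits a as a quotient of
      -- squares.
      have h3 : a * (x i.rev * σ (x i.rev)) = x i * σ (x i) := by
        linear_combination x i.rev * h1 - x i * h2
      apply ha
      rw [eq_div_of_mul_eq (mul_ne_zero hv hσv) h3]
      exact (isSquare_mul_apply σ _).div (isSquare_mul_apply σ _)
  apply hx
  ext i
  rcases hrev i with h | h
  · exact (key i h).1
  · have := (key i.rev (by rwa [Fin.rev_rev])).2
    rwa [Fin.rev_rev] at this

theorem isGreatest_weights_of_odd [Finite F]
    {X : projectiveSystem n σ → Matrix (Fin (n + 1)) (Fin (n + 1)) F} (hX : IsRepresentatives X)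
    (hq : Odd (Nat.card F)) (hn : Odd n) :
    IsGreatest (weights (projectiveCode X))
      (Nat.card F ^ (n - 1) * (Nat.card F ^ (n + 1) - 1) / (Nat.card F - 1)) := by
  have := Fintype.ofFinite F
  have hchar : ringChar F ≠ 2 := by
    intro h
    have := FiniteField.even_card_iff_char_two.1 h
    rw [Nat.card_eq_fintype_card, Nat.odd_iff] at hq
    omega
  obtain ⟨a, ha⟩ := FiniteField.exists_nonsquare hchar
  obtain ⟨h1, h2⟩ := isMaximumWeightCodeword_of_eigenpoints_eq_empty hn.pos hX
    (eigenpoints_antidiagonalMatrix_eq_empty σ hn ha)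
  rw [← h2]
  exact h1.2.2

end MaximumWeight

/-! ### Hyperplanes of semi-standard spread type -/

section SpreadType

variable {F : Type*} [Field F]

/-! ### Semilinear maps with scalar square -/

section Collineation

variable {V : Type*} [AddCommGroup V] [Module F V] {τ : F ≃+* F} {f : V →ₛₗ[(τ : F →+* F)] V}

/-- A semilinear map whose square fixes all the points of a projective space of positive dimension
has a scalar square, and its companion automorphism is involutory. -/
theorem exists_apply_apply_eq_smul [FiniteDimensional F V] (hV : 2 ≤ Module.finrank F V)
    (h : ∀ x, ∃ c : F, f (f x) = c • x) (hf : Function.Injective f) :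
    τ ^ 2 = 1 ∧ ∃ c : F, c ≠ 0 ∧ ∀ x, f (f x) = c • x := by
  -- Compare coefficients in f²(x + a y). Taking a = 1 gives c = d, and then general a gives τ² = 1.
  have key : ∀ {x y : V}, LinearIndependent F ![x, y] → ∀ {c d : F}, f (f x) = c • x →
      f (f y) = d • y → ∀ a, τ (τ a) * d = c * a := by
    intro x y hxy c d hx hy a
    obtain ⟨e, he⟩ := h (x + a • y)
    have h0 : (c - e) • x + (τ (τ a) * d - e * a) • y = 0 := by
      rw [map_add, map_add, map_smulₛₗ, map_smulₛₗ, hx, hy] at he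
      simp only [RingHom.coe_coe] at he
      linear_combination (norm := module) (1 : F) • he
    obtain ⟨h1, h2⟩ := LinearIndependent.pair_iff.1 hxy _ _ h0
    linear_combination h2 - a * h1
  have : Nontrivial V := Module.nontrivial_of_finrank_pos (R := F) (by omega)
  obtain ⟨x, hx⟩ := exists_ne (0 : V)
  obtain ⟨y, hxy⟩ := exists_linearIndependent_pair_of_one_lt_finrank (R := F) (by omega) hx
  obtain ⟨c, hc⟩ := h x
  obtain ⟨d, hd⟩ := h y
  have hcd : d = c := by simpa using key hxy hc hd 1
  have hc0 : c ≠ 0 := by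
    rintro rfl
    rw [zero_smul] at hc
    exact hx (hf (hf (by rw [hc, map_zero, map_zero])))
  have hτ : ∀ a, τ (τ a) = a := fun a => by
    have := key hxy hc hd a
    rw [hcd, mul_comm] at this
    exact mul_left_cancel₀ hc0 this
  refine ⟨RingEquiv.ext fun a => by simpa [pow_two] using hτ a, c, hc0, fun z => ?_⟩
  by_cases hxz : LinearIndependent F ![x, z]
  · obtain ⟨e, he⟩ := h z
    have : e = c := by simpa using key hxz hc he 1
    rw [he, this]
  · rw [LinearIndependent.pair_iff' hx] at hxz
    push Not at hxz
    obtain ⟨t, rfl⟩ := hxz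
    rw [map_smulₛₗ, map_smulₛₗ, hc, RingHom.coe_coe, hτ, smul_comm]

/-- Over a finite field, a non-linear semilinear map with scalar square fixes a projective point:
a multiple of it is an involution, and `v + g v` is fixed by an involution `g`. In particular there
are no fixed-point-free non-linear involutory collineations in this case. -/
theorem exists_apply_eq_smul_of_sq_scalar [Finite F] [Nontrivial V] (hτ : τ ≠ 1) (hτ2 : τ ^ 2 = 1)
    {c : F} (hc0 : c ≠ 0) (hc : ∀ x, f (f x) = c • x) : ∃ x, x ≠ 0 ∧ ∃ a : F, f x = a • x := by
  obtain ⟨x, hx⟩ := exists_ne (0 : V)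
  have hf0 : f x ≠ 0 := by
    intro h
    have := hc x
    rw [h, map_zero, eq_comm, smul_eq_zero] at this
    exact this.elim hc0 hx
  have hτc : τ c = c := by
    have h1 := hc (f x)
    rw [hc x, map_smulₛₗ, RingHom.coe_coe] at h1
    exact smul_left_injective F hf0 h1
  -- With this norm, m f squares to the identity, so it fixes v + m f(v). If these vectors were all
  -- zero, m f = -1 would be linear and τ trivial.
  obtain ⟨m, hm⟩ := exists_mul_apply_eq hτ hτ2 (c := c⁻¹) (by rw [map_inv₀, hτc])
  have hm0 : m ≠ 0 := by
    rintro rfl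
    rw [zero_mul, eq_comm, inv_eq_zero] at hm
    exact hc0 hm
  have hinv : ∀ v, m • f (v + m • f v) = v + m • f v := fun v => by
    rw [map_add, map_smulₛₗ, hc, RingHom.coe_coe, smul_add, smul_smul, smul_smul, hm,
      inv_mul_cancel₀ hc0, one_smul, add_comm]
  by_contra! hno
  have hzero : ∀ v, v + m • f v = 0 := fun v => by
    by_contra hv
    exact hno _ hv m⁻¹ (by rw [eq_inv_smul_iff₀ hm0, hinv])
  apply hτ
  ext a
  have h1 := hzero x
  have h2 := hzero (a • x)
  rw [map_smulₛₗ, RingHom.coe_coe, smul_comm] at h2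
  have h3 : (a - τ a) • x = 0 := by
    linear_combination (norm := module) (1 : F) • h2 - τ a • h1
  rw [RingAut.one_apply]
  exact (sub_eq_zero.1 ((smul_eq_zero.1 h3).resolve_right hx)).symm

/-- If `f` is a semilinear map with scalar square and no eigenvectors, then the lines joining a
point to its image form a spread. -/
theorem linearIndependent_of_sq_scalar {c : F} (hc : ∀ x, f (f x) = c • x)
    (hno : ∀ x, x ≠ 0 → ∀ a : F, f x ≠ a • x) {x y : V} (hx : x ≠ 0)
    (hy : y ∉ Submodule.span F {x, f x}) : LinearIndependent F ![x, f x, y, f y] := by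
  have h2 : LinearIndependent F ![x, f x] := by
    rw [LinearIndependent.pair_iff' hx]
    exact fun a h => hno x hx a h.symm
  have h3 : LinearIndependent F (Fin.snoc ![x, f x] y : Fin 3 → V) := by
    rw [linearIndependent_finSnoc]
    refine ⟨h2, ?_⟩
    rwa [Matrix.range_cons_cons_empty]
  have h4 : LinearIndependent F
      (Fin.snoc (Fin.snoc ![x, f x] y : Fin 3 → V) (f y) : Fin 4 → V) := by
    rw [linearIndependent_finSnoc]
    refine ⟨h3, fun hmem => ?_⟩
    obtain ⟨k, hk⟩ := (Submodule.mem_span_range_iff_exists_fun F).1 hmem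
    have hk' : k 0 • x + k 1 • f x + k 2 • y = f y := by
      rw [← hk, Fin.sum_univ_three]
      rfl
    have hL : ∀ a b : F, a • x + b • f x ∈ Submodule.span F {x, f x} := fun a b =>
      Submodule.mem_span_pair.2 ⟨a, b, rfl⟩
    have happ := congrArg f hk'
    rw [hc y] at happ
    simp only [map_add, map_smulₛₗ, RingHom.coe_coe, hc] at happ
    have hfu : f (k 0 • x + k 1 • f x) = (τ (k 1) * c) • x + τ (k 0) • f x := by
      simp only [map_add, map_smulₛₗ, RingHom.coe_coe, hc]
      module
    -- Apply f to f(y) = u + k₂ y, with u ∈ ⟨x, f(x)⟩, and substitute. As y is outside this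
    -- f-invariant plane, the coefficient vanishes; then f(u) = -τ(k₂) u forces u = 0, and y would
    -- be an eigenvector.
    have h5 : (c - τ (k 2) * k 2) • y =
        f (k 0 • x + k 1 • f x) + τ (k 2) • (k 0 • x + k 1 • f x) := by
      rw [hfu]
      linear_combination (norm := module) (-1 : F) • happ - τ (k 2) • hk'
    have h6 : c - τ (k 2) * k 2 = 0 := by
      by_contra h0
      refine hy ((Submodule.smul_mem_iff _ h0).1 ?_)
      rw [h5, hfu]
      exact Submodule.add_mem _ (hL _ _) (Submodule.smul_mem _ _ (hL _ _))
    rw [h6, zero_smul] at h5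
    have h7 : k 0 • x + k 1 • f x = 0 := by
      by_contra h0
      exact hno _ h0 (-τ (k 2)) (by rw [neg_smul]; exact eq_neg_of_add_eq_zero_left h5.symm)
    rw [h7, zero_add] at hk'
    have hy0 : y ≠ 0 := by
      rintro rfl
      exact hy (Submodule.zero_mem _)
    exact hno y hy0 (k 2) hk'.symm
  have : ![x, f x, y, f y] = Fin.snoc (Fin.snoc ![x, f x] y : Fin 3 → V) (f y) := by
    ext i
    fin_cases i <;> rfl
  rwa [this]

/-- Two semilinear maps spanning the same spread of lines have the same companion automorphism. -/
theorem companion_eq_of_mem_span [FiniteDimensional F V] (hV : 3 ≤ Module.finrank F V)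
    {σ : F ≃+* F} {g : V →ₛₗ[(σ : F →+* F)] V} {c : F} (hc : ∀ x, f (f x) = c • x)
    (hno : ∀ x, x ≠ 0 → ∀ a : F, f x ≠ a • x) (hgno : ∀ x, x ≠ 0 → ∀ a : F, g x ≠ a • x)
    (hg : ∀ x, ∃ a b : F, g x = a • x + b • f x) : σ = τ := by
  have : Nontrivial V := Module.nontrivial_of_finrank_pos (R := F) (by omega)
  obtain ⟨x, hx⟩ := exists_ne (0 : V)
  have h2 : LinearIndependent F ![x, f x] := by
    rw [LinearIndependent.pair_iff' hx]
    exact fun a h => hno x hx a h.symm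
  obtain ⟨y, hy⟩ : ∃ y, y ∉ Submodule.span F {x, f x} := by
    by_contra! h
    have h3 : Submodule.span F {x, f x} = ⊤ := Submodule.eq_top_iff'.2 h
    have h4 := finrank_span_eq_card h2
    rw [Matrix.range_cons_cons_empty, h3, finrank_top, Fintype.card_fin] at h4
    omega
  have hli := linearIndependent_of_sq_scalar hc hno hx hy
  obtain ⟨a, b, hab⟩ := hg x
  obtain ⟨a', b', hab'⟩ := hg y
  have hb : b ≠ 0 := by
    rintro rfl
    exact hgno x hx a (by rw [hab, zero_smul, add_zero])
  -- Compare the coefficients of f(x) and f(y) in g(x + k y). Taking k = 1 gives b' = b, and then σ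
  -- = τ.
  have key : ∀ k : F, σ k * b' = b * τ k := fun k => by
    obtain ⟨d, e, hde⟩ := hg (x + k • y)
    rw [map_add, map_add, map_smulₛₗ, map_smulₛₗ, hab, hab', RingHom.coe_coe, RingHom.coe_coe]
      at hde
    have h0 : (a - d) • x + (b - e) • f x + (σ k * a' - d * k) • y +
        (σ k * b' - e * τ k) • f y = 0 := by
      linear_combination (norm := module) (1 : F) • hde
    have h1 := Fintype.linearIndependent_iff.1 hli
      ![a - d, b - e, σ k * a' - d * k, σ k * b' - e * τ k]
      (by simpa [Fin.sum_univ_four] using h0)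
    have e1 : b - e = 0 := h1 1
    have e2 : σ k * b' - e * τ k = 0 := h1 3
    linear_combination e2 - τ k * e1
  have hbb : b' = b := by simpa using key 1
  ext k
  have := key k
  rw [hbb, mul_comm] at this
  exact mul_left_cancel₀ hb this

end Collineation

variable {n : ℕ}

/-- The number 1 + q + … + q^n of points must be even, which forces q odd and n + 1 even. -/
theorem odd_of_involution_without_fixed_points [Finite F] {φ : PG F n → PG F n}
    (hφ : ∀ p, φ (φ p) = p) (hno : ∀ p, φ p ≠ p) : Odd n := by
  classical
  have := Fintype.ofFinite (PG F n)
  have : Fact (Nat.Prime 2) := ⟨Nat.prime_two⟩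
  have h := Equiv.Perm.card_fixedPoints_modEq (f := (φ : Function.End (PG F n))) (p := 2) (n := 1)
    (funext fun p => hφ p)
  have hempty : IsEmpty (Function.fixedPoints φ) := ⟨fun p => hno p.1 p.2⟩
  have h0 : Fintype.card (Function.fixedPoints φ) = 0 := Fintype.card_eq_zero
  have hcard : Even (Nat.card (PG F n)) := by
    rw [h0] at h
    rw [Nat.even_iff, Nat.card_eq_fintype_card]
    exact h
  rw [Projectivization.card_of_finrank F _ (Module.finrank_fin_fun F)] at hcard
  rcases Nat.even_or_odd (Nat.card F) with hq | hq
  · rw [Finset.sum_range_succ', pow_zero, Nat.even_add_one] at hcard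
    exact absurd (Finset.even_sum _ fun i _ => hq.pow_of_ne_zero (Nat.succ_ne_zero i)) hcard
  · rw [Finset.even_sum_iff_even_card_odd, Finset.filter_true_of_mem fun i _ => hq.pow,
      Finset.card_range, Nat.even_add_one, Nat.not_even_iff_odd] at hcard
    exact hcard

theorem map_eq_self_iff {V : Type*} [AddCommGroup V] [Module F V] {τ : F ≃+* F}
    {f : V →ₛₗ[(τ : F →+* F)] V} (hf : Function.Injective f) {x : V} (hx : x ≠ 0) :
    Projectivization.map f hf (Projectivization.mk F x hx) = Projectivization.mk F x hx ↔
      ∃ a : F, f x = a • x := by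
  rw [Projectivization.map_mk, Projectivization.mk_eq_mk_iff']
  simp only [eq_comm]

theorem exists_smul_of_map_map {V : Type*} [AddCommGroup V] [Module F V] {τ : F ≃+* F}
    {f : V →ₛₗ[(τ : F →+* F)] V} (hf : Function.Injective f)
    (h : ∀ p : ℙ F V, Projectivization.map f hf (Projectivization.map f hf p) = p) (x : V) :
    ∃ c : F, f (f x) = c • x := by
  by_cases hx : x = 0
  · exact ⟨0, by simp [hx]⟩
  · have := h (Projectivization.mk F x hx)
    rw [Projectivization.map_mk, Projectivization.map_mk, Projectivization.mk_eq_mk_iff'] at this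
    obtain ⟨c, hc⟩ := this
    exact ⟨c, hc.symm⟩

/-- The matrix of a semilinear map. -/
theorem exists_twistedMap_eq {σ : F ≃+* F}
    (f : (Fin (n + 1) → F) →ₛₗ[(σ : F →+* F)] (Fin (n + 1) → F)) :
    ∃ M, twistedMap σ M = f := by
  refine ⟨Matrix.of fun i j => f (Pi.single j 1) i, ?_⟩
  ext x i
  conv_rhs => rw [pi_eq_sum_univ' x, map_sum]
  rw [twistedMap_apply, Finset.sum_apply, Matrix.mulVec, dotProduct]
  refine Finset.sum_congr rfl fun j _ => ?_
  rw [map_smulₛₗ, Pi.smul_apply, smul_eq_mul, mul_comm]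
  rfl

theorem mem_spread_mk {τ : F ≃+* F}
    {f : (Fin (n + 1) → F) →ₛₗ[(τ : F →+* F)] (Fin (n + 1) → F)} (hf : Function.Injective f)
    {x ξ : Fin (n + 1) → F} (hx : x ≠ 0) (hξ : ξ ≠ 0) :
    Incident (Projectivization.map f hf (Projectivization.mk F x hx)) (Projectivization.mk F ξ hξ) ↔
      ξ ⬝ᵥ f x = 0 :=
  Iff.rfl

theorem spreadType_of_eq_arisingHyperplane [Finite F] {σ : F ≃+* F}
    {X : projectiveSystem n σ → Matrix (Fin (n + 1)) (Fin (n + 1)) F} (hX : IsRepresentatives X)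
    {M : Matrix (Fin (n + 1)) (Fin (n + 1)) F}
    (hH : IsSemiStandardSpreadType (arisingHyperplane σ M)) :
    σ ^ 2 = 1 ∧ Odd n ∧ IsMaximumWeightCodeword (projectiveCode X) (codeword X M) ∧
      weight (codeword X M) =
        Nat.card F ^ (n - 1) * (Nat.card F ^ (n + 1) - 1) / (Nat.card F - 1) := by
  obtain ⟨τ, f, hf, hτ, hinv, hfree, hM⟩ := hH
  have hodd : Odd n := odd_of_involution_without_fixed_points hinv hfree
  have hn : 1 ≤ n := hodd.pos
  have hno : ∀ x, x ≠ 0 → ∀ a : F, f x ≠ a • x := fun x hx a h =>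
    hfree _ ((map_eq_self_iff hf hx).2 ⟨a, h⟩)
  obtain ⟨hτ2, c, hc0, hc⟩ := exists_apply_apply_eq_smul
    (by rw [Module.finrank_fin_fun]; omega) (exists_smul_of_map_map hf hinv) hf
  have hmem : ∀ x ξ : Fin (n + 1) → F, x ≠ 0 → ξ ≠ 0 → ξ ⬝ᵥ x = 0 →
      (ξ ⬝ᵥ twistedMap σ M x = 0 ↔ ξ ⬝ᵥ f x = 0) := by
    intro x ξ hx hξ h
    have hinc : Incident (Projectivization.mk F x hx) (Projectivization.mk F ξ hξ) := h
    rw [← mk_mem_arisingHyperplane hx hξ hinc, hM, ← mem_spread_mk hf hx hξ]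
    rfl
  have hspan : ∀ x, x ≠ 0 → twistedMap σ M x ∈ Submodule.span F {x, f x} := by
    intro x hx
    by_contra hnot
    obtain ⟨ξ, hξ, hne⟩ := exists_dotProduct_ne_zero hnot
    rw [mem_annihilator_span] at hξ
    have hξ0 : ξ ≠ 0 := fun h => hne (by rw [h, zero_dotProduct])
    exact hne ((hmem x ξ hx hξ0 (hξ x (by simp))).2 (hξ _ (by simp)))
  -- At an eigenvector every hyperplane through x would belong to the set, hence contain f(x),
  -- making x an eigenvector of f.
  have hgno : ∀ x, x ≠ 0 → ∀ a : F, twistedMap σ M x ≠ a • x := by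
    intro x hx a ha
    have : f x ∉ Submodule.span F {x} := fun h => by
      obtain ⟨b, hb⟩ := Submodule.mem_span_singleton.1 h
      exact hno x hx b hb.symm
    obtain ⟨ξ, hξ, hne⟩ := exists_dotProduct_ne_zero this
    rw [mem_annihilator_span] at hξ
    have hξ0 : ξ ≠ 0 := fun h => hne (by rw [h, zero_dotProduct])
    refine hne ((hmem x ξ hx hξ0 (hξ x rfl)).1 ?_)
    rw [ha, dotProduct_smul, hξ x rfl, smul_zero]
  have hempty : eigenpoints (twistedMap σ M) = ∅ := by
    rw [Set.eq_empty_iff_forall_notMem]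
    intro p hp
    induction p using Projectivization.ind with | h x hx =>
    obtain ⟨a, ha⟩ := (mk_mem_eigenpoints hx).1 hp
    exact hgno x hx a ha
  refine ⟨?_, hodd, isMaximumWeightCodeword_of_eigenpoints_eq_empty hn hX hempty⟩
  -- For n = 1, ⟨x, f(x)⟩ is the whole space and the spread argument is void; here f itself cannot
  -- exist.
  rcases hn.eq_or_lt with rfl | hn2
  · obtain ⟨x, hx, a, ha⟩ := exists_apply_eq_smul_of_sq_scalar hτ hτ2 hc0 hc
    exact absurd ha (hno x hx a)
  · rw [companion_eq_of_mem_span (by rw [Module.finrank_fin_fun]; omega) hc hno hgno fun x => ?_,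
      hτ2]
    by_cases hx : x = 0
    · exact ⟨0, 0, by simp [hx]⟩
    · obtain ⟨a, b, h⟩ := Submodule.mem_span_pair.1 (hspan x hx)
      exact ⟨a, b, h.symm⟩

theorem exists_eq_arisingHyperplane_of_spreadType [Finite F] {σ : F ≃+* F} (hσ : σ ≠ 1)
    (hσ2 : σ ^ 2 = 1) {H : Set (PHPoint F n)} (hH : IsSemiStandardSpreadType H) :
    ∃ M : Matrix (Fin (n + 1)) (Fin (n + 1)) F, M ≠ 0 ∧ H = arisingHyperplane σ M := by
  obtain ⟨τ, f, hf, hτ, hinv, hfree, rfl⟩ := hH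
  have hn : 1 ≤ n := (odd_of_involution_without_fixed_points hinv hfree).pos
  obtain ⟨hτ2, -⟩ := exists_apply_apply_eq_smul
    (by rw [Module.finrank_fin_fun]; omega) (exists_smul_of_map_map hf hinv) hf
  -- Both automorphisms are x ↦ x ^ s with s² = q, so the involution is unique.
  have hτσ : τ = σ := by
    have h1 := (card_eq_card_fixed_sq hτ hτ2).symm.trans (card_eq_card_fixed_sq hσ hσ2)
    ext a
    rw [apply_eq_pow_card_fixed hτ hτ2, apply_eq_pow_card_fixed hσ hσ2,
      Nat.pow_left_injective (by norm_num : (2 : ℕ) ≠ 0) h1]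
  subst hτσ
  obtain ⟨M, hM⟩ := exists_twistedMap_eq f
  refine ⟨M, ?_, ?_⟩
  · rintro rfl
    have h1 : f (Pi.single 0 1) = f 0 := by
      rw [← hM, twistedMap_apply, Matrix.zero_mulVec, map_zero]
    have h2 := congrFun (hf h1) 0
    simp at h2
  · ext ⟨p, H, h⟩
    induction p using Projectivization.ind with | h x hx =>
    induction H using Projectivization.ind with | h ξ hξ =>
    rw [mk_mem_arisingHyperplane, hM]
    rfl

end SpreadType

end TwistedCode

open TwistedCode in
theorem theorem2 {F : Type*} [Field F] [Finite F] (n : ℕ) (σ : F ≃+* F) (hσ : σ ≠ 1)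
    (X : projectiveSystem n σ → Matrix (Fin (n + 1)) (Fin (n + 1)) F) (hX : IsRepresentatives X)
    (q s : ℕ) (hq : q = Nat.card F) (hs : s = Nat.card {a : F // σ a = a}) :
    -- the code is minimal
    (2 ≤ n → IsMinimalCode (projectiveCode X)) ∧
    -- the plane case with an involutory automorphism
    (n = 2 → σ ^ 2 = 1 →
      q = s ^ 2 ∧
      IsLeast (weights (projectiveCode X)) (q ^ 3 - s ^ 3) ∧
      ∀ M : Matrix (Fin (n + 1)) (Fin (n + 1)) F, M ≠ 0 →
        (IsMinimumWeightCodeword (projectiveCode X) (codeword X M) ↔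
          ∃ (ξ : Fin 3 → Fin (n + 1) → F) (α : Fin 3 → F),
            LinearIndependent F ξ ∧ (∀ i, α i ≠ 0) ∧
            (∀ i, ξ i ᵥ* M = α i • fun k => σ (ξ i k)) ∧
            ∀ i j, α i ^ (s + 1) = α j ^ (s + 1))) ∧
    -- the remaining cases
    (2 ≤ n → 2 < n ∨ σ ^ 2 ≠ 1 →
      IsLeast (weights (projectiveCode X)) (q ^ (2 * n - 1) - q ^ (n - 1)) ∧
      IsLeast (nonMinimumWeights (projectiveCode X)) (q ^ (2 * n - 1)) ∧
      (∀ M : Matrix (Fin (n + 1)) (Fin (n + 1)) F, M ≠ 0 →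
        (IsMinimumWeightCodeword (projectiveCode X) (codeword X M) ↔
          IsQuasiSingular (arisingHyperplane σ M) ∧ ¬ IsSingular (arisingHyperplane σ M)) ∧
        (IsSecondLowestWeightCodeword (projectiveCode X) (codeword X M) ↔
          IsSingular (arisingHyperplane σ M))) ∧
      (∀ H : Set (PHPoint F n), IsQuasiSingular H →
        ∃ M : Matrix (Fin (n + 1)) (Fin (n + 1)) F, M ≠ 0 ∧ H = arisingHyperplane σ M)) ∧
    -- maximum weight codewords
    (Odd q → Odd n →
      IsGreatest (weights (projectiveCode X)) (q ^ (n - 1) * (q ^ (n + 1) - 1) / (q - 1))) ∧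
    (∀ H : Set (PHPoint F n), IsSemiStandardSpreadType H →
      (∀ M : Matrix (Fin (n + 1)) (Fin (n + 1)) F, M ≠ 0 → H = arisingHyperplane σ M →
        σ ^ 2 = 1 ∧ Odd n ∧
        IsMaximumWeightCodeword (projectiveCode X) (codeword X M) ∧
        weight (codeword X M) = q ^ (n - 1) * (q ^ (n + 1) - 1) / (q - 1)) ∧
      (σ ^ 2 = 1 →
        ∃ M : Matrix (Fin (n + 1)) (Fin (n + 1)) F, M ≠ 0 ∧ H = arisingHyperplane σ M)) := by
  subst hq hs
  refine ⟨isMinimalCode_projectiveCode hσ hX, ?_, fun hn h => ?_, isGreatest_weights_of_odd hX,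
    fun H hH => ⟨?_, fun hσ2 => exists_eq_arisingHyperplane_of_spreadType hσ hσ2 hH⟩⟩
  · rintro rfl hσ2
    exact ⟨card_eq_card_fixed_sq hσ hσ2, plane_minimum_weight hσ hσ2 hX⟩
  · obtain ⟨h1, h2, h3⟩ := low_weights hX hσ hn h
    refine ⟨h1, h2, h3, ?_⟩
    rintro _ ⟨p, A, rfl⟩
    obtain ⟨a, b, ha, hb, -, hqs⟩ := exists_eq_quasiSingular hn σ (p := p) (A := A)
    exact ⟨_, vecMulVec_twist_ne_zero σ ha hb, hqs⟩
  · rintro M - rfl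
    exact spreadType_of_eq_arisingHyperplane hX hH
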